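/- Write $e(t)=e^{2\pi i t}$ and $\hat g(\xi)=\int_{\mathbb R} g(x)\,e(-\xi x)\,dx$. For $g:\mathbb R\to\mathbb C$, $\theta\in\mathbb R$ and an integer $k\ge 0$ put $\mathrm{Mod}_\theta g(x)=e(\theta x)\,g(x)$ and $g_k(t)=2^{-k}g(2^{-k}t)$. Let $\chi$ be a Schwartz function on $\mathbb R$ with $\mathbf 1_{[-1/4,1/4]}\le\hat\chi\le\mathbf 1_{[-1/2,1/2]}$, let $\Theta=\{\theta_1,\dots,\theta_N\}\subset\mathbb R$ be $1$-separated, i.e. $|\theta_i-\theta_j|>1$ for $i\ne j$, and for an integer $k_0\ge 0$ and $f\in L^2(\mathbb R)$ set \[ \mathcal M_{\Theta}f(x)=\mathcal M_{\Theta,k_0}f(x)=\sup_{k\ge k_0}\Big|\sum_{n\le N}\big((\mathrm{Mod}_{\theta_n}\chi_k)*f\big)(x)\Big| ,\] the supremum being over integers $k$. Then for every $\epsilon>0$ there is a constant $C_\epsilon$, depending only on $\epsilon$ (not on $\chi$, $k_0$, $N$, $\Theta$, $f$), such that \[ \|\mathcal M_{\Theta}f\|_{L^2(\mathbb R)}\le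 C_\epsilon\, N^{\epsilon}\,\|f\|_{L^2(\mathbb R)} .\] Moreover, there is an absolute constant $C$ such that, whenever $N\ge 2$, \[ \|\mathcal M_{\Theta}f\|_{L^2(\mathbb R)}\le C\,\log^2 N\,\|f\|_{L^2(\mathbb R)} .\] -/

import Mathlib

open MeasureTheory
open scoped ENNReal NNReal SchwartzMap FourierTransform Convolution

noncomputable section

namespace MultiFreq

/-- `1_{[-1/4,1/4]} ≤ χ̂ ≤ 1_{[-1/2,1/2]}` (in particular `χ̂` is real valued), where
`χ̂(ξ) = ∫ χ(x) e^{-2πixξ} dx`. -/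
def IsAdmissible (χ : 𝓢(ℝ, ℂ)) : Prop :=
  ∀ ξ : ℝ, (𝓕 (χ : ℝ → ℂ) ξ).im = 0 ∧
    Set.indicator (Set.Icc (-1 / 4 : ℝ) (1 / 4)) (fun _ => (1 : ℝ)) ξ ≤ (𝓕 (χ : ℝ → ℂ) ξ).re ∧
    (𝓕 (χ : ℝ → ℂ) ξ).re ≤ Set.indicator (Set.Icc (-1 / 2 : ℝ) (1 / 2)) (fun _ => (1 : ℝ)) ξ

/-- The `L¹`-normalized dyadic dilation `φ_k(t) = 2^{-k} φ(2^{-k} t)`. -/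
def dil (k : ℕ) (φ : ℝ → ℂ) : ℝ → ℂ :=
  fun t => ((2 : ℂ) ^ k)⁻¹ * φ (((2 : ℝ) ^ k)⁻¹ * t)

/-- The modulation `Mod_θ g(x) = e^{2πiθx} g(x)`. -/
def modulate (θ : ℝ) (g : ℝ → ℂ) : ℝ → ℂ :=
  fun x => Complex.exp (2 * Real.pi * Complex.I * (θ * x : ℝ)) * g x

/-- `Ξ_k f = ∑_{n ≤ N} (Mod_{θ_n} χ_k) * f`. -/
def Xi {N : ℕ} (χ : ℝ → ℂ) (θ : Fin N → ℝ) (k : ℕ) (f : ℝ → ℂ) : ℝ → ℂ :=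
  fun x => ∑ n : Fin N,
    (modulate (θ n) (dil k χ) ⋆[ContinuousLinearMap.mul ℂ ℂ, volume] f) x

/-- `sup_{k ≥ k₀} |Ξ_k f(x)|`, as an element of `[0, ∞]`. -/
def maximalFn {N : ℕ} (χ : ℝ → ℂ) (θ : Fin N → ℝ) (k₀ : ℕ) (f : ℝ → ℂ) : ℝ → ℝ≥0∞ :=
  fun x => ⨆ (k : ℕ) (_ : k₀ ≤ k), ‖Xi χ θ k f x‖ₑ

/-- `1`-separation: `|θ_i - θ_j| > 1` for `i ≠ j`. -/
def OneSeparated {N : ℕ} (θ : Fin N → ℝ) : Prop :=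
  ∀ i j : Fin N, i ≠ j → 1 < |θ i - θ j|

end MultiFreq

end

/-!
Moving the frequencies near each `θ n` to the origin turns `f` into a vector valued function `g`,
and the `k`-th sum into the exponential sum `∑ n, e(θ n x) v n` evaluated at `v = (χ_k * g) x`.

The multiplier of `χ_k` differs from that of the average against a tent of width comparable to
`2 ^ k` by a function that decays at both low and high frequencies, so the maximal function of the
differences is dominated by a square function, which Plancherel's theorem bounds without loss in
`N`: the modulated components of `g` have disjoint Fourier supports. A tent average is a mean, over
the translates of a dyadic grid, of averages over the intervals of that grid.

On a single grid the averages form a martingale. For each of the thresholds `2 ^ (-i)`, `i ≤ L`,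
relative to the running maximum, where `N ≤ 2 ^ L`, follow the martingale greedily, moving an anchor
only when it is too far away. An exponential sum has norm at most `N`, so at the last threshold the
error is at most the running maximum, which Doob's inequality controls. The differences of
consecutive anchors change only at jumps, the squares of the jumps sum up by orthogonality of
martingale differences, and on an interval of length `1` the large sieve bounds each exponential sum
in `L²` by the norm of `v`. With `O(log N)` thresholds this gives the bound `O(log N)`.
-/

noncomputable section

namespace MultiFreq

section Chaining

variable {H : Type*} [NormedAddCommGroup H]

/-- One greedy step: the anchor `a` moves to `v` when `v` is farther than `δ * M` from it. -/
def anchor (δ M : ℝ) (v a : H) : H :=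
  open Classical in if δ * M < ‖v - a‖ then v else a

/-- The running maximum of the norms along a path, started at `M`. -/
def runMax : ℝ → List H → ℝ
  | M, [] => M
  | M, v :: l => runMax (max M ‖v‖) l

/-- The sum of the squared jumps of the greedy anchor with threshold `δ` relative to the running
maximum, where `M` and `a` are the initial maximum and anchor. -/
def jumpSum (δ : ℝ) : ℝ → H → List H → ℝ
  | _, _, [] => 0
  | M, a, v :: l =>
    ‖anchor δ (max M ‖v‖) v a - a‖ ^ 2 + jumpSum δ (max M ‖v‖) (anchor δ (max M ‖v‖) v a) l

/-- The sum of `q` over the differences of two greedy anchors with thresholds `δ` and `δ'`, taken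
only at the times at which at least one of them jumps. -/
def pairSum (q : H → ℝ≥0∞) (δ δ' : ℝ) : ℝ → H → H → List H → ℝ≥0∞
  | _, _, _, [] => 0
  | M, a, a', v :: l =>
    (open Classical in
      if anchor δ (max M ‖v‖) v a = a ∧ anchor δ' (max M ‖v‖) v a' = a' then 0
      else q (anchor δ' (max M ‖v‖) v a' - anchor δ (max M ‖v‖) v a)) +
    pairSum q δ δ' (max M ‖v‖) (anchor δ (max M ‖v‖) v a) (anchor δ' (max M ‖v‖) v a') l

lemma norm_sub_anchor_le {δ M : ℝ} (hδ : 0 ≤ δ) (hM : 0 ≤ M) (v a : H) :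
    ‖v - anchor δ M v a‖ ≤ δ * M := by
  unfold anchor
  split_ifs with h
  · simpa using mul_nonneg hδ hM
  · exact not_lt.1 h

lemma lt_norm_anchor_sub {δ M : ℝ} {v a : H} (h : anchor δ M v a ≠ a) :
    δ * M < ‖anchor δ M v a - a‖ := by
  unfold anchor at h ⊢
  split_ifs with hv
  · exact hv
  · simp [hv] at h

lemma anchor_one_zero (M : ℝ) (v : H) : anchor 1 (max M ‖v‖) v 0 = 0 := by
  simp [anchor]

lemma le_runMax (M : ℝ) (l : List H) : M ≤ runMax M l := by
  induction l generalizing M with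
  | nil => exact le_rfl
  | cons v l ih => exact (le_max_left _ _).trans (ih _)

lemma jumpSum_nonneg (δ M : ℝ) (a : H) (l : List H) : 0 ≤ jumpSum δ M a l := by
  induction l generalizing M a with
  | nil => exact le_rfl
  | cons v l ih => exact add_nonneg (by positivity) (ih _ _)

lemma norm_anchor_sub_anchor_sq_le {δ M : ℝ} (hδ : 0 ≤ δ) (hM : 0 ≤ M) {v a a' : H}
    (h : ¬(anchor δ M v a = a ∧ anchor (δ / 2) M v a' = a')) :
    ‖anchor (δ / 2) M v a' - anchor δ M v a‖ ^ 2 ≤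
      9 * (‖anchor δ M v a - a‖ ^ 2 + ‖anchor (δ / 2) M v a' - a'‖ ^ 2) := by
  have hpos : 0 ≤ δ / 2 * M := by positivity
  have hclose := norm_sub_anchor_le hδ hM v a
  have hclose' := norm_sub_anchor_le (div_nonneg hδ zero_le_two) hM v a'
  set b := anchor δ M v a
  set b' := anchor (δ / 2) M v a'
  have hdist : ‖b' - b‖ ≤ 3 * (δ / 2 * M) := by
    calc ‖b' - b‖ = ‖(v - b) - (v - b')‖ := by congr 1; abel
      _ ≤ ‖v - b‖ + ‖v - b'‖ := norm_sub_le _ _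
      _ ≤ 3 * (δ / 2 * M) := by linarith
  have hjump : (δ / 2 * M) ^ 2 ≤ ‖b - a‖ ^ 2 + ‖b' - a'‖ ^ 2 := by
    rcases not_and_or.1 h with hb | hb'
    · have : δ / 2 * M ≤ ‖b - a‖ := by linarith [lt_norm_anchor_sub hb]
      exact (pow_le_pow_left₀ hpos this 2).trans (le_add_of_nonneg_right (sq_nonneg _))
    · have : δ / 2 * M ≤ ‖b' - a'‖ := (lt_norm_anchor_sub hb').le
      exact (pow_le_pow_left₀ hpos this 2).trans (le_add_of_nonneg_left (sq_nonneg _))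
  calc ‖b' - b‖ ^ 2 ≤ (3 * (δ / 2 * M)) ^ 2 := by gcongr
    _ = 9 * (δ / 2 * M) ^ 2 := by ring
    _ ≤ 9 * (‖b - a‖ ^ 2 + ‖b' - a'‖ ^ 2) := by gcongr

lemma pairSum_le_jumpSum {q : H → ℝ≥0∞} {C : ℝ≥0∞} (hq : ∀ p, q p ≤ C * ‖p‖ₑ ^ 2)
    {δ : ℝ} (hδ : 0 ≤ δ) {M : ℝ} (hM : 0 ≤ M) (a a' : H) (l : List H) :
    pairSum q δ (δ / 2) M a a' l ≤
      C * ENNReal.ofReal (9 * (jumpSum δ M a l + jumpSum (δ / 2) M a' l)) := by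
  induction l generalizing M a a' with
  | nil => simp [pairSum]
  | cons v l ih =>
    have hM' : 0 ≤ max M ‖v‖ := le_max_of_le_left hM
    simp only [pairSum, jumpSum]
    rw [add_add_add_comm, mul_add 9, ENNReal.ofReal_add (by positivity)
      (by linarith [jumpSum_nonneg δ (max M ‖v‖) (anchor δ (max M ‖v‖) v a) l,
        jumpSum_nonneg (δ / 2) (max M ‖v‖) (anchor (δ / 2) (max M ‖v‖) v a') l]), mul_add]
    refine add_le_add ?_ (ih hM' _ _)
    split_ifs with h
    · exact zero_le
    · refine (hq _).trans ?_
      rw [← ofReal_norm, ← ENNReal.ofReal_pow (norm_nonneg _)]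
      gcongr
      exact norm_anchor_sub_anchor_sq_le hδ hM' h

lemma measurable_pairSum {α : Type*} [MeasurableSpace α] {q : α → H → ℝ≥0∞}
    (hq : ∀ p, Measurable fun x => q x p) (δ δ' M : ℝ) (a a' : H) (l : List H) :
    Measurable fun x => pairSum (q x) δ δ' M a a' l := by
  induction l generalizing M a a' with
  | nil => exact measurable_const
  | cons v l ih =>
    simp only [pairSum]
    split_ifs
    exacts [measurable_const.add (ih _ _ _), (hq _).add (ih _ _ _)]

lemma lintegral_pairSum {α : Type*} [MeasurableSpace α] (μ : Measure α) {q : α → H → ℝ≥0∞}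
    (hq : ∀ p, Measurable fun x => q x p) (δ δ' M : ℝ) (a a' : H) (l : List H) :
    ∫⁻ x, pairSum (q x) δ δ' M a a' l ∂μ = pairSum (fun p => ∫⁻ x, q x p ∂μ) δ δ' M a a' l := by
  induction l generalizing M a a' with
  | nil => exact lintegral_zero
  | cons v l ih =>
    simp only [pairSum]
    split_ifs
    · simpa only [zero_add] using ih _ _ _
    · rw [lintegral_add_left (hq _), ih]

variable {E F : Type*} [NormedAddCommGroup E] [FunLike F H E] [AddMonoidHomClass F H E]

lemma add_sum_range_sq_le (x : ℝ≥0∞) (y : ℕ → ℝ≥0∞) (L : ℕ) :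
    (x + ∑ i ∈ Finset.range L, y i) ^ 2 ≤
      (L + 1) * (x ^ 2 + ∑ i ∈ Finset.range L, y i ^ 2) := by
  have h := ENNReal.rpow_sum_le_const_mul_sum_rpow (Finset.range (L + 1))
    (fun i => Nat.casesOn i x y) (one_le_two (α := ℝ))
  rw [Finset.sum_range_succ', Finset.sum_range_succ', add_comm, add_comm _ (_ ^ _)] at h
  norm_num at h
  exact_mod_cast h

lemma enorm_le_anchor_chain (ℓ : F) {L : ℕ} (hℓ : ∀ v, ‖ℓ v‖ ≤ 2 ^ L * ‖v‖) {M : ℝ}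
    {a : ℕ → H} (ha : a 0 = 0) (v : H) :
    ‖ℓ v‖ₑ ≤ ENNReal.ofReal (max M ‖v‖) + ∑ i ∈ Finset.range L,
      ‖ℓ (anchor (2⁻¹ ^ (i + 1)) (max M ‖v‖) v (a (i + 1)) -
        anchor (2⁻¹ ^ i) (max M ‖v‖) v (a i))‖ₑ := by
  set R := max M ‖v‖
  have hR : 0 ≤ R := (norm_nonneg v).trans (le_max_right M _)
  set b : ℕ → H := fun i => anchor (2⁻¹ ^ i) R v (a i)
  have hb : b 0 = 0 := by simp [b, R, ha, anchor_one_zero]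
  have htelescope : v = (v - b L) + ∑ i ∈ Finset.range L, (b (i + 1) - b i) := by
    rw [Finset.sum_range_sub, hb]; abel
  have hlast : ‖ℓ (v - b L)‖ ≤ R :=
    calc ‖ℓ (v - b L)‖ ≤ 2 ^ L * (2⁻¹ ^ L * R) :=
          (hℓ _).trans (by gcongr; exact norm_sub_anchor_le (by positivity) hR v (a L))
      _ = R := by rw [← mul_assoc, ← mul_pow]; norm_num
  calc ‖ℓ v‖ₑ = ‖ℓ (v - b L) + ∑ i ∈ Finset.range L, ℓ (b (i + 1) - b i)‖ₑ := by
        rw [← map_sum, ← map_add, ← htelescope]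
    _ ≤ ‖ℓ (v - b L)‖ₑ + ∑ i ∈ Finset.range L, ‖ℓ (b (i + 1) - b i)‖ₑ :=
        (enorm_add_le _ _).trans (by gcongr; exact enorm_sum_le _ _)
    _ ≤ ENNReal.ofReal R + ∑ i ∈ Finset.range L, ‖ℓ (b (i + 1) - b i)‖ₑ := by
        rw [← ofReal_norm]; gcongr

lemma enorm_sq_le_pairSum (ℓ : F) {L : ℕ} (hℓ : ∀ v, ‖ℓ v‖ ≤ 2 ^ L * ‖v‖) {M : ℝ} {a : ℕ → H}
    (ha : a 0 = 0) {l : List H} {v : H} (hv : v ∈ l) :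
    ‖ℓ v‖ₑ ^ 2 ≤ (L + 1) * (ENNReal.ofReal (runMax M l) ^ 2 +
      ∑ i ∈ Finset.range L, (‖ℓ (a (i + 1) - a i)‖ₑ ^ 2 +
        pairSum (fun p => ‖ℓ p‖ₑ ^ 2) (2⁻¹ ^ i) (2⁻¹ ^ (i + 1)) M (a i) (a (i + 1)) l)) := by
  induction l generalizing M a with
  | nil => cases hv
  | cons w l ih =>
    set b : ℕ → H := fun i => anchor (2⁻¹ ^ i) (max M ‖w‖) w (a i) with hb
    have hstep : ∀ i, ‖ℓ (b (i + 1) - b i)‖ₑ ^ 2 + pairSum (fun p => ‖ℓ p‖ₑ ^ 2) (2⁻¹ ^ i)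
        (2⁻¹ ^ (i + 1)) (max M ‖w‖) (b i) (b (i + 1)) l ≤ ‖ℓ (a (i + 1) - a i)‖ₑ ^ 2 +
        pairSum (fun p => ‖ℓ p‖ₑ ^ 2) (2⁻¹ ^ i) (2⁻¹ ^ (i + 1)) M (a i) (a (i + 1)) (w :: l) := by
      intro i
      simp only [pairSum]
      split_ifs with h
      · simp only [hb, h.1, h.2, zero_add, le_refl]
      · exact le_add_self
    rcases List.mem_cons.1 hv with rfl | hv
    · calc ‖ℓ v‖ₑ ^ 2 ≤ _ := pow_le_pow_left' (enorm_le_anchor_chain ℓ hℓ ha v) 2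
        _ ≤ _ := add_sum_range_sq_le _ _ L
        _ ≤ _ := by
          gcongr with i
          · exact le_runMax _ l
          · exact le_self_add.trans (hstep i)
    · refine (ih (M := max M ‖w‖) (a := b) ?_ hv).trans ?_
      · simp [hb, ha, anchor_one_zero]
      · exact mul_le_mul' le_rfl (add_le_add le_rfl (Finset.sum_le_sum fun i _ => hstep i))

/-- In the application `l` lists the averages along the path to a leaf of the dyadic tree, and `μ`
is Lebesgue measure on that leaf. -/
lemma lintegral_iSup_mem_enorm_sq_le {α : Type*} [MeasurableSpace α] {μ : Measure α}
    (hμ : μ Set.univ ≤ 1) {ℓ : α → F} (hmeas : ∀ v, Measurable fun x => ‖ℓ x v‖ₑ) {L : ℕ}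
    (hℓ : ∀ x v, ‖ℓ x v‖ ≤ 2 ^ L * ‖v‖) {C : ℝ≥0∞}
    (hC : ∀ v, ∫⁻ x, ‖ℓ x v‖ₑ ^ 2 ∂μ ≤ C * ‖v‖ₑ ^ 2) (l : List H) :
    ∫⁻ x, ⨆ v ∈ l, ‖ℓ x v‖ₑ ^ 2 ∂μ ≤ (L + 1) * (ENNReal.ofReal (runMax 0 l ^ 2) +
      ∑ i ∈ Finset.range L, C * ENNReal.ofReal
        (9 * (jumpSum (2⁻¹ ^ i) 0 0 l + jumpSum (2⁻¹ ^ (i + 1)) 0 0 l))) := by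
  set P : ℕ → α → ℝ≥0∞ := fun i x =>
    pairSum (fun p => ‖ℓ x p‖ₑ ^ 2) (2⁻¹ ^ i) (2⁻¹ ^ (i + 1)) 0 0 0 l
  have hPm : ∀ i, Measurable (P i) := fun i =>
    measurable_pairSum (fun p => (hmeas p).pow_const 2) _ _ _ _ _ _
  have hP : ∀ i, ∫⁻ x, P i x ∂μ ≤ C * ENNReal.ofReal
      (9 * (jumpSum (2⁻¹ ^ i) 0 0 l + jumpSum (2⁻¹ ^ (i + 1)) 0 0 l)) := by
    intro i
    rw [lintegral_pairSum μ (fun p => (hmeas p).pow_const 2), pow_succ, ← div_eq_mul_inv]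
    exact pairSum_le_jumpSum hC (by positivity) le_rfl _ _ _
  have hpoint : ∀ x, ⨆ v ∈ l, ‖ℓ x v‖ₑ ^ 2 ≤
      (L + 1) * (ENNReal.ofReal (runMax 0 l ^ 2) + ∑ i ∈ Finset.range L, P i x) := by
    refine fun x => iSup₂_le fun v hv => ?_
    have h := enorm_sq_le_pairSum (ℓ x) (hℓ x) (M := 0) (a := fun _ => 0) rfl hv
    simpa [P, ENNReal.ofReal_pow (le_runMax 0 l)] using h
  calc ∫⁻ x, ⨆ v ∈ l, ‖ℓ x v‖ₑ ^ 2 ∂μ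
      ≤ ∫⁻ x, (L + 1) * (ENNReal.ofReal (runMax 0 l ^ 2) + ∑ i ∈ Finset.range L, P i x) ∂μ :=
        lintegral_mono hpoint
    _ = (L + 1) * (ENNReal.ofReal (runMax 0 l ^ 2) * μ Set.univ +
          ∑ i ∈ Finset.range L, ∫⁻ x, P i x ∂μ) := by
        rw [lintegral_const_mul _ (by fun_prop), lintegral_add_left measurable_const,
          lintegral_finsetSum _ fun i _ => hPm i, lintegral_const]
    _ ≤ _ := by
        gcongr with i
        exacts [mul_le_of_le_one_right' hμ, hP i]

end Chaining

section DyadicTree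

variable {H : Type*} {A : ℕ → ℝ → H}

/-- The left endpoint of the block of length `T` containing `x`, in the grid `a + T * ℤ`. -/
def gridFloor (T a x : ℝ) : ℝ := a + T * ⌊(x - a) / T⌋

lemma gridFloor_eq_left {T a x : ℝ} (h : x ∈ Set.Ico a (a + T)) : gridFloor T a x = a := by
  have hT : 0 < T := by linarith [h.1, h.2]
  have : ⌊(x - a) / T⌋ = 0 := Int.floor_eq_zero_iff.2
    ⟨div_nonneg (sub_nonneg.2 h.1) hT.le, (div_lt_one hT).2 (by linarith [h.2])⟩
  simp [gridFloor, this]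

lemma gridFloor_add_mul_int {T : ℝ} (hT : T ≠ 0) (a x : ℝ) (n : ℤ) :
    gridFloor T (a + T * n) x = gridFloor T a x := by
  have : (x - (a + T * n)) / T = (x - a) / T - n := by field_simp; ring
  rw [gridFloor, this, Int.floor_sub_intCast, gridFloor]
  push_cast
  ring

lemma gridFloor_congr {T : ℕ} {a x : ℝ} {m : ℕ} (hx : x ∈ Set.Ico (a + m) (a + m + 1)) :
    gridFloor T a x = gridFloor T a (a + m) := by
  have : ⌊x - a⌋ = m := Int.floor_eq_iff.2
    ⟨by push_cast; linarith [hx.1], by push_cast; linarith [hx.2]⟩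
  rw [gridFloor, gridFloor, Int.floor_div_natCast, this, add_sub_cancel_left,
    Int.floor_div_natCast, Int.floor_natCast]

/-- The values of `A` on the blocks of length `2 ^ K`, …, `2`, `1` containing `x`, in the grids with
origin `a`. -/
def path (A : ℕ → ℝ → H) (a x : ℝ) : ℕ → List H
  | 0 => [A 0 (gridFloor (2 ^ 0) a x)]
  | K + 1 => A (K + 1) (gridFloor (2 ^ (K + 1)) a x) :: path A a x K

lemma mem_path {k K : ℕ} (hk : k ≤ K) (a x : ℝ) : A k (gridFloor (2 ^ k) a x) ∈ path A a x K := by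
  induction K, hk using Nat.le_induction with
  | base => cases k <;> simp [path]
  | succ K _ ih => exact List.mem_cons_of_mem _ ih

lemma path_congr {a x y : ℝ} {K : ℕ}
    (h : ∀ k ≤ K, gridFloor (2 ^ k) a x = gridFloor (2 ^ k) a y) :
    path A a x K = path A a y K := by
  induction K with
  | zero => simp only [path, h 0 le_rfl]
  | succ K ih => simp only [path, h (K + 1) le_rfl, ih fun k hk => h k (hk.trans K.le_succ)]

lemma path_add_pow (a x : ℝ) {k K : ℕ} (hk : k ≤ K) :
    path A (a + 2 ^ K) x k = path A a x k := by
  have hgrid : ∀ j ≤ K, gridFloor (2 ^ j) (a + 2 ^ K) x = gridFloor (2 ^ j) a x := by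
    intro j hj
    have := gridFloor_add_mul_int (pow_ne_zero j two_ne_zero) a x (2 ^ (K - j))
    rwa [Int.cast_pow, Int.cast_ofNat, ← pow_add, Nat.add_sub_cancel' hj] at this
  induction k with
  | zero => simp only [path, hgrid 0 hk]
  | succ k ih => simp only [path, hgrid (k + 1) hk, ih (k.le_succ.trans hk)]

lemma path_zero (a : ℝ) : path A a a 0 = [A 0 a] := by
  rw [path, gridFloor_eq_left (by simp)]

lemma path_succ {a x : ℝ} {K : ℕ} (hx : x ∈ Set.Ico a (a + 2 ^ (K + 1))) :
    path A a x (K + 1) = A (K + 1) a :: path A a x K := by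
  rw [path, gridFloor_eq_left hx]

lemma sum_path_succ {Y : Type*} [AddCommMonoid Y] (K : ℕ) (a : ℝ) (Φ : List H → Y) :
    ∑ m ∈ Finset.range (2 ^ (K + 1)), Φ (path A a (a + m) (K + 1)) =
      (∑ m ∈ Finset.range (2 ^ K), Φ (A (K + 1) a :: path A a (a + m) K)) +
      ∑ m ∈ Finset.range (2 ^ K),
        Φ (A (K + 1) a :: path A (a + 2 ^ K) (a + 2 ^ K + m) K) := by
  have hcons : ∀ m ∈ Finset.range (2 ^ (K + 1)), Φ (path A a (a + m) (K + 1)) =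
      Φ (A (K + 1) a :: path A a (a + m) K) := by
    intro m hm
    have : (m : ℝ) < 2 ^ (K + 1) := by exact_mod_cast Finset.mem_range.1 hm
    rw [path_succ ⟨by simp, by simpa using this⟩]
  rw [Finset.sum_congr rfl hcons, pow_succ, mul_two, Finset.sum_range_add]
  simp [path_add_pow a _ le_rfl, add_assoc]

lemma setLIntegral_Ico_add_natCast (f : ℝ → ℝ≥0∞) (a : ℝ) (n : ℕ) :
    ∫⁻ x in Set.Ico a (a + n), f x =
      ∑ m ∈ Finset.range n, ∫⁻ x in Set.Ico (a + m) (a + m + 1), f x := by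
  induction n with
  | zero => simp
  | succ n ih =>
    rw [Finset.sum_range_succ, ← ih, ← lintegral_union measurableSet_Ico
      (Set.Ico_disjoint_Ico_same), Set.Ico_union_Ico_eq_Ico (by simp) (by simp)]
    simp [add_assoc]

lemma setLIntegral_path (K : ℕ) (a : ℝ) (Ψ : ℝ → List H → ℝ≥0∞) :
    ∫⁻ x in Set.Ico a (a + 2 ^ K), Ψ x (path A a x K) = ∑ m ∈ Finset.range (2 ^ K),
      ∫⁻ x in Set.Ico (a + m) (a + m + 1), Ψ x (path A a (a + m) K) := by
  have h := setLIntegral_Ico_add_natCast (fun x => Ψ x (path A a x K)) a (2 ^ K)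
  rw [Nat.cast_pow, Nat.cast_ofNat] at h
  refine h.trans (Finset.sum_congr rfl fun m _ => ?_)
  refine setLIntegral_congr_fun measurableSet_Ico fun x hx => ?_
  have hgrid : ∀ k ≤ K, gridFloor (2 ^ k) a x = gridFloor (2 ^ k) a (a + m) := fun k _ => by
    exact_mod_cast gridFloor_congr (T := 2 ^ k) hx
  simp only [path_congr hgrid]

end DyadicTree

section Averages

variable {H : Type*} [NormedAddCommGroup H]

lemma ofReal_integral_norm_sq {g : ℝ → H} (hg : Continuous g) {a b : ℝ} (hab : a ≤ b) :
    ENNReal.ofReal (∫ t in a..b, ‖g t‖ ^ 2) = ∫⁻ t in Set.Ico a b, ‖g t‖ₑ ^ 2 := by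
  rw [intervalIntegral.integral_of_le hab, ← integral_Ico_eq_integral_Ioc,
    ofReal_integral_eq_lintegral_ofReal
      (Continuous.integrableOn_Icc (by fun_prop) |>.mono_set Set.Ico_subset_Icc_self)
      (.of_forall fun _ => by positivity)]
  simp_rw [ENNReal.ofReal_pow (norm_nonneg _), ofReal_norm]

section NormedSpace

variable [NormedSpace ℝ H]

/-- The average of `g` over the interval from `a` to `a + T`; it makes sense for `T` of either
sign, and equals `g a` for `T = 0`. -/
def segmentAvg (g : ℝ → H) (T a : ℝ) : H := ∫ s in (0 : ℝ)..1, g (a + T * s)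

lemma smul_segmentAvg (g : ℝ → H) (T a : ℝ) : T • segmentAvg g T a = ∫ t in a..a + T, g t := by
  simp [segmentAvg, intervalIntegral.smul_integral_comp_add_mul]

lemma integral_add_two_mul {g : ℝ → H} (hg : Continuous g) (T a : ℝ) :
    ∫ t in a..a + T * 2, g t = (∫ t in a..a + T, g t) + ∫ t in a + T..a + T + T, g t := by
  rw [intervalIntegral.integral_add_adjacent_intervals (hg.intervalIntegrable _ _)
    (hg.intervalIntegrable _ _), mul_two, add_assoc]

lemma two_mul_norm_segmentAvg_le {g : ℝ → H} (hg : Continuous g) {T : ℝ} (hT : T ≠ 0) (a : ℝ) :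
    2 * ‖segmentAvg g (T * 2) a‖ ≤ ‖segmentAvg g T a‖ + ‖segmentAvg g T (a + T)‖ := by
  have h : (2 : ℝ) • segmentAvg g (T * 2) a = segmentAvg g T a + segmentAvg g T (a + T) := by
    refine smul_right_injective H hT ?_
    simp only [smul_add, smul_segmentAvg, smul_smul, integral_add_two_mul hg]
  calc 2 * ‖segmentAvg g (T * 2) a‖ = ‖(2 : ℝ) • segmentAvg g (T * 2) a‖ := by
        rw [norm_smul, Real.norm_ofNat]
    _ ≤ _ := h ▸ norm_add_le _ _

lemma continuous_segmentAvg {g : ℝ → H} (hg : Continuous g) (T : ℝ) :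
    Continuous (segmentAvg g T) :=
  intervalIntegral.continuous_parametric_intervalIntegral_of_continuous' (by fun_prop) 0 1

end NormedSpace

variable [InnerProductSpace ℝ H] [CompleteSpace H]

lemma integral_norm_sub_sq {g : ℝ → H} (hg : Continuous g) (T a : ℝ) (c : H) :
    ∫ t in a..a + T, ‖g t - c‖ ^ 2 =
      T * ‖segmentAvg g T a - c‖ ^ 2 + ∫ t in a..a + T, ‖g t - segmentAvg g T a‖ ^ 2 := by
  set v := segmentAvg g T a with hv
  have hexpand : ∀ t,
      ‖g t - c‖ ^ 2 = ‖v - c‖ ^ 2 + 2 * inner ℝ (v - c) (g t - v) + ‖g t - v‖ ^ 2 := by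
    intro t
    rw [← norm_add_sq_real]; congr 2; abel
  have hcross : ∫ t in a..a + T, inner ℝ (v - c) (g t - v) = 0 := by
    have h := (innerSL ℝ (v - c)).intervalIntegral_comp_comm (μ := volume)
      (f := fun t => g t - v) (a := a) (b := a + T)
      ((hg.sub continuous_const).intervalIntegrable _ _)
    simp only [innerSL_apply_apply] at h
    rw [h, intervalIntegral.integral_sub (hg.intervalIntegrable _ _) (by simp),
      ← smul_segmentAvg, ← hv]
    simp
  have hsq : Continuous fun t => ‖g t - v‖ ^ 2 := by fun_prop
  simp_rw [hexpand]
  rw [intervalIntegral.integral_add (Continuous.intervalIntegrable (by fun_prop) _ _)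
    (hsq.intervalIntegrable _ _), intervalIntegral.integral_add (by simp)
    (Continuous.intervalIntegrable (by fun_prop) _ _), intervalIntegral.integral_const_mul, hcross]
  simp

lemma mul_norm_segmentAvg_sub_sq_le {g : ℝ → H} (hg : Continuous g) {T : ℝ}
    (hT : 0 ≤ T) (a : ℝ) (c : H) :
    T * ‖segmentAvg g T a - c‖ ^ 2 ≤ ∫ t in a..a + T, ‖g t - c‖ ^ 2 := by
  rw [integral_norm_sub_sq hg]
  exact le_add_of_nonneg_right
    (intervalIntegral.integral_nonneg (by simpa) fun _ _ => by positivity)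

lemma mul_norm_anchor_sub_sq_add_le {g : ℝ → H} (hg : Continuous g)
    (T a : ℝ) (c : H) (δ M : ℝ) :
    T * ‖anchor δ M (segmentAvg g T a) c - c‖ ^ 2 +
      ∫ t in a..a + T, ‖g t - anchor δ M (segmentAvg g T a) c‖ ^ 2 ≤
      ∫ t in a..a + T, ‖g t - c‖ ^ 2 := by
  unfold anchor
  split_ifs
  · exact (integral_norm_sub_sq hg T a c).ge
  · simp

lemma sum_jumpSum_path_le {g : ℝ → H} (hg : Continuous g) (K : ℕ) (a δ M : ℝ)
    (c : H) :
    ∑ m ∈ Finset.range (2 ^ K),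
      jumpSum δ M c (path (fun k => segmentAvg g (2 ^ k)) a (a + m) K) ≤
      ∫ t in a..a + 2 ^ K, ‖g t - c‖ ^ 2 := by
  induction K generalizing a M c with
  | zero =>
    have h := mul_norm_anchor_sub_sq_add_le hg 1 a c δ (max M ‖segmentAvg g 1 a‖)
    have hrest : 0 ≤ ∫ t in a..a + 1,
        ‖g t - anchor δ (max M ‖segmentAvg g 1 a‖) (segmentAvg g 1 a) c‖ ^ 2 :=
      intervalIntegral.integral_nonneg (by simp) fun _ _ => by positivity
    simp only [pow_zero, Finset.range_one, Finset.sum_singleton, Nat.cast_zero, add_zero,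
      path_zero, jumpSum]
    linarith
  | succ K ih =>
    set v := segmentAvg g (2 ^ (K + 1)) a with hv
    set M' := max M ‖v‖
    set b := anchor δ M' v c with hb
    have h := mul_norm_anchor_sub_sq_add_le hg (2 ^ (K + 1)) a c δ M'
    rw [← hv, ← hb, pow_succ (2 : ℝ) K,
      integral_add_two_mul (g := fun t => ‖g t - b‖ ^ 2) (by fun_prop)] at h
    rw [sum_path_succ]
    simp only [jumpSum, Finset.sum_add_distrib, Finset.sum_const, Finset.card_range, nsmul_eq_mul,
      Nat.cast_pow, Nat.cast_ofNat]
    rw [← hv, ← hb, pow_succ (2 : ℝ) K]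
    linarith [ih a M' b, ih (a + 2 ^ K) M' b]

/-- Doob's maximal inequality via the potential `2 M ^ 2 - 4 M ‖v‖`, which decreases in mean along
the tree. -/
lemma sum_runMax_sq_path_le_potential {g : ℝ → H} (hg : Continuous g) (K : ℕ)
    (a : ℝ) {M : ℝ} (hM : 0 ≤ M) :
    ∑ m ∈ Finset.range (2 ^ K),
      runMax M (path (fun k => segmentAvg g (2 ^ k)) a (a + m) K) ^ 2 ≤
      2 ^ K * (2 * max M ‖segmentAvg g (2 ^ K) a‖ ^ 2 -
        4 * max M ‖segmentAvg g (2 ^ K) a‖ * ‖segmentAvg g (2 ^ K) a‖) +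
      4 * ∫ t in a..a + 2 ^ K, ‖g t‖ ^ 2 := by
  induction K generalizing a M with
  | zero =>
    have h := mul_norm_segmentAvg_sub_sq_le hg zero_le_one a 0
    simp only [sub_zero, one_mul] at h
    simp only [pow_zero, Finset.range_one, Finset.sum_singleton, Nat.cast_zero, add_zero,
      path_zero, runMax, one_mul]
    nlinarith [sq_nonneg (max M ‖segmentAvg g 1 a‖ - 2 * ‖segmentAvg g 1 a‖)]
  | succ K ih =>
    rw [sum_path_succ K a fun l => runMax M l ^ 2]
    simp only [runMax]
    set X := ‖segmentAvg g (2 ^ (K + 1)) a‖ with hX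
    set M' := max M X
    have hM' : 0 ≤ M' := le_max_of_le_left hM
    have hleft := ih a hM'
    have hright := ih (a + 2 ^ K) hM'
    have hXX : 2 * X ≤ ‖segmentAvg g (2 ^ K) a‖ + ‖segmentAvg g (2 ^ K) (a + 2 ^ K)‖ := by
      rw [hX, pow_succ]
      exact two_mul_norm_segmentAvg_le hg (by positivity) a
    set X₁ := ‖segmentAvg g (2 ^ K) a‖
    set X₂ := ‖segmentAvg g (2 ^ K) (a + 2 ^ K)‖
    have hdecrease : ∀ Y, 2 * max M' Y ^ 2 - 4 * max M' Y * Y ≤ 2 * M' ^ 2 - 4 * M' * Y := by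
      intro Y
      rcases le_total Y M' with h | h
      · rw [max_eq_left h]
      · rw [max_eq_right h]; nlinarith [sq_nonneg (Y - M')]
    have hpotential : (2 : ℝ) ^ K * ((2 * max M' X₁ ^ 2 - 4 * max M' X₁ * X₁) +
        (2 * max M' X₂ ^ 2 - 4 * max M' X₂ * X₂)) ≤ 2 ^ K * (2 * (2 * M' ^ 2 - 4 * M' * X)) := by
      gcongr
      nlinarith [hdecrease X₁, hdecrease X₂, mul_le_mul_of_nonneg_left hXX hM']
    rw [pow_succ (2 : ℝ) K, integral_add_two_mul (g := fun t => ‖g t‖ ^ 2) (by fun_prop)]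
    linarith

lemma sum_runMax_sq_path_le {g : ℝ → H} (hg : Continuous g) (K : ℕ) (a : ℝ) :
    ∑ m ∈ Finset.range (2 ^ K),
      runMax 0 (path (fun k => segmentAvg g (2 ^ k)) a (a + m) K) ^ 2 ≤
      4 * ∫ t in a..a + 2 ^ K, ‖g t‖ ^ 2 := by
  refine (sum_runMax_sq_path_le_potential hg K a le_rfl).trans ?_
  rw [max_eq_right (norm_nonneg _)]
  nlinarith [mul_nonneg (pow_nonneg zero_le_two K) (sq_nonneg ‖segmentAvg g (2 ^ K) a‖)]

lemma sum_ofReal_runMax_sq_path_le {g : ℝ → H} (hg : Continuous g) (K : ℕ) (a : ℝ) :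
    ∑ m ∈ Finset.range (2 ^ K), ENNReal.ofReal
      (runMax 0 (path (fun k => segmentAvg g (2 ^ k)) a (a + m) K) ^ 2) ≤
      4 * ∫⁻ t in Set.Ico a (a + 2 ^ K), ‖g t‖ₑ ^ 2 := by
  rw [← ofReal_integral_norm_sq hg (by simp),
    ← ENNReal.ofReal_sum_of_nonneg fun _ _ => by positivity, ← ENNReal.ofReal_ofNat,
    ← ENNReal.ofReal_mul zero_le_four]
  exact ENNReal.ofReal_le_ofReal (sum_runMax_sq_path_le hg K a)

lemma sum_ofReal_jumpSum_add_jumpSum_path_le {g : ℝ → H} (hg : Continuous g) (K : ℕ)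
    (a δ δ' : ℝ) :
    ∑ m ∈ Finset.range (2 ^ K), ENNReal.ofReal
      (9 * (jumpSum δ 0 0 (path (fun k => segmentAvg g (2 ^ k)) a (a + m) K) +
        jumpSum δ' 0 0 (path (fun k => segmentAvg g (2 ^ k)) a (a + m) K))) ≤
      18 * ∫⁻ t in Set.Ico a (a + 2 ^ K), ‖g t‖ₑ ^ 2 := by
  rw [← ofReal_integral_norm_sq hg (by simp),
    ← ENNReal.ofReal_sum_of_nonneg fun _ _ => mul_nonneg (by norm_num)
      (add_nonneg (jumpSum_nonneg _ _ _ _) (jumpSum_nonneg _ _ _ _)), ← ENNReal.ofReal_ofNat,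
    ← ENNReal.ofReal_mul (by norm_num), ← Finset.mul_sum, Finset.sum_add_distrib]
  refine ENNReal.ofReal_le_ofReal ?_
  have h := sum_jumpSum_path_le hg K a δ 0 0
  have h' := sum_jumpSum_path_le hg K a δ' 0 0
  simp only [sub_zero] at h h'
  linarith

theorem setLIntegral_iSup_segmentAvg_gridFloor_le {E F : Type*}
    [NormedAddCommGroup E] [FunLike F H E] [AddMonoidHomClass F H E]
    {g : ℝ → H} (hg : Continuous g) {ℓ : ℝ → F} (hmeas : ∀ v, Measurable fun x => ‖ℓ x v‖ₑ)
    {L : ℕ} (hℓ : ∀ x v, ‖ℓ x v‖ ≤ 2 ^ L * ‖v‖) {C : ℝ≥0∞}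
    (hC : ∀ b v, ∫⁻ x in Set.Ico b (b + 1), ‖ℓ x v‖ₑ ^ 2 ≤ C * ‖v‖ₑ ^ 2) (K : ℕ) (a : ℝ) :
    ∫⁻ x in Set.Ico a (a + 2 ^ K),
        ⨆ k ≤ K, ‖ℓ x (segmentAvg g (2 ^ k) (gridFloor (2 ^ k) a x))‖ₑ ^ 2 ≤
      (L + 1) * (4 + L * (18 * C)) * ∫⁻ t in Set.Ico a (a + 2 ^ K), ‖g t‖ₑ ^ 2 := by
  set A : ℕ → ℝ → H := fun k => segmentAvg g (2 ^ k)
  set I := ∫⁻ t in Set.Ico a (a + 2 ^ K), ‖g t‖ₑ ^ 2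
  calc ∫⁻ x in Set.Ico a (a + 2 ^ K), ⨆ k ≤ K, ‖ℓ x (A k (gridFloor (2 ^ k) a x))‖ₑ ^ 2
      ≤ ∫⁻ x in Set.Ico a (a + 2 ^ K), ⨆ v ∈ path A a x K, ‖ℓ x v‖ₑ ^ 2 := by
        gcongr with x
        exact iSup₂_le fun k hk => le_iSup₂_of_le _ (mem_path hk a x) le_rfl
    _ = ∑ m ∈ Finset.range (2 ^ K), ∫⁻ x in Set.Ico (a + m) (a + m + 1),
          ⨆ v ∈ path A a (a + m) K, ‖ℓ x v‖ₑ ^ 2 :=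
        setLIntegral_path K a fun x l => ⨆ v ∈ l, ‖ℓ x v‖ₑ ^ 2
    _ ≤ ∑ m ∈ Finset.range (2 ^ K), (L + 1) *
          (ENNReal.ofReal (runMax 0 (path A a (a + m) K) ^ 2) +
            ∑ i ∈ Finset.range L, C * ENNReal.ofReal
              (9 * (jumpSum (2⁻¹ ^ i) 0 0 (path A a (a + m) K) +
                jumpSum (2⁻¹ ^ (i + 1)) 0 0 (path A a (a + m) K)))) := by
        gcongr with m
        exact lintegral_iSup_mem_enorm_sq_le (by simp) hmeas hℓ (hC _) _
    _ ≤ (L + 1) * (4 * I + ∑ _i ∈ Finset.range L, C * (18 * I)) := by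
        rw [← Finset.mul_sum, Finset.sum_add_distrib, Finset.sum_comm]
        refine mul_le_mul' le_rfl (add_le_add (sum_ofReal_runMax_sq_path_le hg K a)
          (Finset.sum_le_sum fun i _ => ?_))
        rw [← Finset.mul_sum]
        exact mul_le_mul' le_rfl (sum_ofReal_jumpSum_add_jumpSum_path_le hg K a _ _)
    _ = (L + 1) * (4 + L * (18 * C)) * I := by
        rw [Finset.sum_const, Finset.card_range, nsmul_eq_mul]
        ring

end Averages

section GridAveraging

lemma integral_fract_natCast_mul {E : Type*} [NormedAddCommGroup E] [NormedSpace ℝ E]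
    {Φ : ℝ → E} (hΦ : Continuous Φ) {n : ℕ} (hn : n ≠ 0) :
    ∫ y in (0 : ℝ)..1, Φ (Int.fract (n * y)) = ∫ y in (0 : ℝ)..1, Φ y := by
  set ψ : ℝ → E := fun y => Φ (Int.fract y)
  have hper : Function.Periodic ψ 1 := (Int.fract_periodic ℝ).comp Φ
  have heq : Set.EqOn ψ Φ (Set.uIoo 0 1) := by
    intro y hy
    rw [Set.uIoo_of_le zero_le_one] at hy
    simp only [ψ, Int.fract_eq_self.2 ⟨hy.1.le, hy.2⟩]
  have hint : IntervalIntegrable ψ volume 0 (0 + 1) :=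
    (zero_add (1 : ℝ)).symm ▸ (hΦ.intervalIntegrable 0 1).congr_uIoo heq.symm
  have hperiods := hper.intervalIntegral_add_zsmul_eq n 0
    fun _ _ => hper.intervalIntegrable one_ne_zero hint _ _
  simp only [zero_add, zsmul_eq_mul, mul_one, Int.cast_natCast, natCast_zsmul] at hperiods
  have hn' : (n : ℝ) ≠ 0 := Nat.cast_ne_zero.2 hn
  rw [intervalIntegral.integral_comp_mul_left ψ hn', mul_zero, mul_one, hperiods,
    intervalIntegral.integral_congr_uIoo heq, ← Nat.cast_smul_eq_nsmul ℝ, inv_smul_smul₀ hn']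

lemma enorm_integral_sq_le {E α : Type*} [NormedAddCommGroup E] [NormedSpace ℝ E]
    [MeasurableSpace α] {μ : Measure α} [IsProbabilityMeasure μ] {f : α → E}
    (hf : AEStronglyMeasurable f μ) : ‖∫ x, f x ∂μ‖ₑ ^ 2 ≤ ∫⁻ x, ‖f x‖ₑ ^ 2 ∂μ := by
  have h := eLpNorm'_le_eLpNorm'_of_exponent_le one_pos one_le_two μ hf
  simp only [eLpNorm', ENNReal.rpow_one, div_one] at h
  calc ‖∫ x, f x ∂μ‖ₑ ^ 2 ≤ ((∫⁻ x, ‖f x‖ₑ ^ (2 : ℝ) ∂μ) ^ (1 / 2 : ℝ)) ^ 2 :=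
        pow_le_pow_left' ((enorm_integral_le_lintegral_enorm f).trans h) 2
    _ = ∫⁻ x, ‖f x‖ₑ ^ 2 ∂μ := by
        rw [← ENNReal.rpow_natCast, ← ENNReal.rpow_mul]
        norm_num

lemma lintegral_lintegral_sub_mul {μ : Measure ℝ} [SFinite μ] {S : ℝ → ℝ → ℝ≥0∞}
    (hS : Measurable (Function.uncurry S)) (c : ℝ) :
    ∫⁻ x, ∫⁻ y, S (x - c * y) x ∂μ = ∫⁻ u, ∫⁻ y, S u (u + c * y) ∂μ := by
  have hl : Measurable fun p : ℝ × ℝ => S (p.1 - c * p.2) p.1 :=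
    hS.comp (f := fun p : ℝ × ℝ => (p.1 - c * p.2, p.1)) (by fun_prop)
  have hr : Measurable fun p : ℝ × ℝ => S p.1 (p.1 + c * p.2) :=
    hS.comp (f := fun p : ℝ × ℝ => (p.1, p.1 + c * p.2)) (by fun_prop)
  rw [lintegral_lintegral_swap (f := fun x y => S (x - c * y) x) hl.aemeasurable,
    lintegral_lintegral_swap (f := fun u y => S u (u + c * y)) hr.aemeasurable]
  refine lintegral_congr fun y => ?_
  rw [← lintegral_add_right_eq_self (fun x => S (x - c * y) x) (c * y)]
  simp only [add_sub_cancel_right]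

lemma setLIntegral_Ico_add_mul (f : ℝ → ℝ≥0∞) (a : ℝ) {T : ℝ} (hT : 0 < T) :
    ∫⁻ x in Set.Ico a (a + T), f x =
      ENNReal.ofReal T * ∫⁻ y in Set.Ico (0 : ℝ) 1, f (a + T * y) := by
  have himage : (fun y => T * y + a) '' Set.Ico 0 1 = Set.Ico a (a + T) := by
    rw [Set.image_affine_Ico hT]; ring_nf
  have hderiv : ∀ y ∈ Set.Ico (0 : ℝ) 1,
      HasDerivWithinAt (fun y => T * y + a) T (Set.Ico 0 1) y := fun y _ => by
    simpa using (((hasDerivAt_id y).const_mul T).add_const a).hasDerivWithinAt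
  rw [← himage, lintegral_image_eq_lintegral_abs_deriv_mul measurableSet_Ico hderiv
    fun x _ y _ h => by simpa [hT.ne'] using h, lintegral_const_mul' _ _ ENNReal.ofReal_ne_top,
    abs_of_pos hT]
  simp_rw [add_comm a]

lemma lintegral_iSup_le_of_forall_partial {α : Type*} [MeasurableSpace α] {μ : Measure α}
    {F : ℕ → α → ℝ≥0∞} (hF : ∀ k, Measurable (F k)) {B : ℝ≥0∞}
    (h : ∀ K, ∫⁻ x, ⨆ k ≤ K, F k x ∂μ ≤ B) : ∫⁻ x, ⨆ k, F k x ∂μ ≤ B := by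
  calc ∫⁻ x, ⨆ k, F k x ∂μ = ∫⁻ x, ⨆ K, ⨆ k ≤ K, F k x ∂μ := by simp_rw [biSup_le_eq_iSup]
    _ = ⨆ K, ∫⁻ x, ⨆ k ≤ K, F k x ∂μ := lintegral_iSup
        (fun K => .iSup fun k => .iSup fun _ => hF k)
        fun _ _ hK x => biSup_mono fun _ hk => hk.trans hK
    _ ≤ B := iSup_le h

section TentAverages

variable {H : Type*} [NormedAddCommGroup H] [NormedSpace ℝ H]

/-- The average of the averages of `g` over the intervals of length `T` containing `x`, that is, the
convolution of `g` with the `L¹`-normalized tent of half-width `T`. -/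
def tentAvg (g : ℝ → H) (T x : ℝ) : H := ∫ y in (0 : ℝ)..1, segmentAvg g T (x - T * y)

lemma continuous_tentAvg {g : ℝ → H} (hg : Continuous g) (T : ℝ) : Continuous (tentAvg g T) := by
  have := continuous_segmentAvg hg T
  exact intervalIntegral.continuous_parametric_intervalIntegral_of_continuous' (by fun_prop) 0 1

variable [CompleteSpace H] {E : Type*} [NormedAddCommGroup E] [NormedSpace ℝ E] [CompleteSpace E]

/-- Averaging the dyadic averages over all translates of the grid of length `T` gives the tent
average; it does not matter by how large a multiple of `T` the grid is translated. -/
lemma map_tentAvg_eq_integral_gridFloor (ℓ : H →L[ℝ] E) {g : ℝ → H} (hg : Continuous g) {T : ℝ}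
    (hT : T ≠ 0) {n : ℕ} (hn : n ≠ 0) (x : ℝ) :
    ℓ (tentAvg g T x) =
      ∫ y in (0 : ℝ)..1, ℓ (segmentAvg g T (gridFloor T (x - T * n * y) x)) := by
  have hcont := continuous_segmentAvg hg T
  have hgrid : ∀ y : ℝ, gridFloor T (x - T * n * y) x = x - T * Int.fract (n * y) := by
    intro y
    have : (x - (x - T * n * y)) / T = n * y := by field_simp; ring
    rw [gridFloor, this, Int.fract]
    ring
  simp_rw [hgrid]
  rw [integral_fract_natCast_mul (Φ := fun y => ℓ (segmentAvg g T (x - T * y))) (by fun_prop) hn,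
    ℓ.intervalIntegral_comp_comm (Continuous.intervalIntegrable (by fun_prop) _ _)]
  rfl

end TentAverages

section GridMax

variable {H E : Type*} [NormedAddCommGroup H] [NormedSpace ℝ H]
  [NormedAddCommGroup E] [NormedSpace ℝ E]

/-- The maximal function over the dyadic grid with origin `u`: the supremum over `k ≤ K` of
`‖ℓ x v‖ ^ 2`, where `v` is the average of `g` over the grid interval of length `2 ^ k` that
contains `x`. -/
def gridMax (ℓ : ℝ → H →L[ℝ] E) (g : ℝ → H) (K : ℕ) (u x : ℝ) : ℝ≥0∞ :=
  ⨆ k ≤ K, ‖ℓ x (segmentAvg g (2 ^ k) (gridFloor (2 ^ k) u x))‖ₑ ^ 2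

lemma measurable_gridFloor (T : ℝ) : Measurable fun p : ℝ × ℝ => gridFloor T p.1 p.2 := by
  unfold gridFloor; fun_prop

lemma measurable_gridMax {ℓ : ℝ → H →L[ℝ] E} (hℓ : Continuous ℓ) {g : ℝ → H} (hg : Continuous g)
    (K : ℕ) : Measurable (Function.uncurry (gridMax ℓ g K)) := by
  refine .iSup fun k => .iSup fun _ => ?_
  have hcont := continuous_segmentAvg hg (2 ^ k)
  exact (Continuous.measurable (f := fun q : ℝ × ℝ => ‖ℓ q.1 (segmentAvg g (2 ^ k) q.2)‖ₑ ^ 2)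
    (by fun_prop)).comp (measurable_snd.prodMk (measurable_gridFloor (2 ^ k)))

lemma iSup_tentAvg_le_lintegral_gridMax [CompleteSpace H] [CompleteSpace E] (ℓ : ℝ → H →L[ℝ] E)
    {g : ℝ → H} (hg : Continuous g) (K : ℕ) (x : ℝ) :
    ⨆ k ≤ K, ‖ℓ x (tentAvg g (2 ^ k) x)‖ₑ ^ 2 ≤
      ∫⁻ y in Set.Ico 0 1, gridMax ℓ g K (x - 2 ^ K * y) x := by
  have : IsProbabilityMeasure (volume.restrict (Set.Ico (0 : ℝ) 1)) := ⟨by simp⟩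
  refine iSup₂_le fun k hk => ?_
  have hpow : (2 : ℝ) ^ k * ((2 ^ (K - k) : ℕ) : ℝ) = 2 ^ K := by
    rw [Nat.cast_pow, Nat.cast_ofNat, ← pow_add, Nat.add_sub_cancel' hk]
  have hmeas : Measurable fun y => gridFloor (2 ^ k) (x - 2 ^ K * y) x :=
    (measurable_gridFloor _).comp (f := fun y => (x - 2 ^ K * y, x)) (by fun_prop)
  rw [map_tentAvg_eq_integral_gridFloor (ℓ x) hg (by positivity)
    (n := 2 ^ (K - k)) (by positivity), intervalIntegral.integral_of_le zero_le_one,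
    ← integral_Ico_eq_integral_Ioc, hpow]
  refine (enorm_integral_sq_le (((ℓ x).continuous.comp
    (continuous_segmentAvg hg _)).comp_aestronglyMeasurable hmeas.aestronglyMeasurable)).trans
    (lintegral_mono fun y => ?_)
  exact le_iSup₂_of_le (f := fun k (_ : k ≤ K) =>
    ‖ℓ x (segmentAvg g (2 ^ k) (gridFloor (2 ^ k) (x - 2 ^ K * y) x))‖ₑ ^ 2) k hk le_rfl

end GridMax

theorem lintegral_iSup_tentAvg_le {H E : Type*} [NormedAddCommGroup H] [InnerProductSpace ℝ H]
    [CompleteSpace H] [NormedAddCommGroup E] [NormedSpace ℝ E] [CompleteSpace E]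
    {g : ℝ → H} (hg : Continuous g) {ℓ : ℝ → H →L[ℝ] E}
    (hcont : Continuous ℓ) {L : ℕ} (hℓ : ∀ x v, ‖ℓ x v‖ ≤ 2 ^ L * ‖v‖) {C : ℝ≥0}
    (hC : ∀ b v, ∫⁻ x in Set.Ico b (b + 1), ‖ℓ x v‖ₑ ^ 2 ≤ C * ‖v‖ₑ ^ 2) :
    ∫⁻ x, ⨆ k : ℕ, ‖ℓ x (tentAvg g (2 ^ k) x)‖ₑ ^ 2 ≤
      (L + 1) * (4 + L * (18 * C)) * ∫⁻ x, ‖g x‖ₑ ^ 2 := by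
  have htent := fun k : ℕ => continuous_tentAvg hg (2 ^ k)
  refine lintegral_iSup_le_of_forall_partial (fun k => Continuous.measurable (by fun_prop))
    fun K => ?_
  have hK : (0 : ℝ) < 2 ^ K := by positivity
  have hblock : ∀ u, ∫⁻ y in Set.Ico 0 1, gridMax ℓ g K u (u + 2 ^ K * y) ≤
      (L + 1) * (4 + L * (18 * C)) * ∫⁻ y in Set.Ico (0 : ℝ) 1, ‖g (u + 2 ^ K * y)‖ₑ ^ 2 := by
    intro u
    have h := setLIntegral_iSup_segmentAvg_gridFloor_le hg
      (fun v => Continuous.measurable (by fun_prop)) hℓ hC K u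
    rw [setLIntegral_Ico_add_mul _ u hK, setLIntegral_Ico_add_mul _ u hK, mul_left_comm] at h
    exact (ENNReal.mul_le_mul_iff_right (by simp) ENNReal.ofReal_ne_top).1 h
  calc ∫⁻ x, ⨆ k ≤ K, ‖ℓ x (tentAvg g (2 ^ k) x)‖ₑ ^ 2
      ≤ ∫⁻ x, ∫⁻ y in Set.Ico 0 1, gridMax ℓ g K (x - 2 ^ K * y) x :=
        lintegral_mono (iSup_tentAvg_le_lintegral_gridMax ℓ hg K)
    _ = ∫⁻ u, ∫⁻ y in Set.Ico 0 1, gridMax ℓ g K u (u + 2 ^ K * y) :=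
        lintegral_lintegral_sub_mul (measurable_gridMax hcont hg K) _
    _ ≤ ∫⁻ u, (L + 1) * (4 + L * (18 * C)) *
          ∫⁻ y in Set.Ico (0 : ℝ) 1, ‖g (u + 2 ^ K * y)‖ₑ ^ 2 := lintegral_mono hblock
    _ = (L + 1) * (4 + L * (18 * C)) *
          ∫⁻ u, ∫⁻ y in Set.Ico (0 : ℝ) 1, ‖g (u + 2 ^ K * y)‖ₑ ^ 2 :=
        lintegral_const_mul' _ _ (by finiteness)
    _ = (L + 1) * (4 + L * (18 * C)) * ∫⁻ x, ‖g x‖ₑ ^ 2 := by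
        rw [← lintegral_lintegral_sub_mul (S := fun _ x => ‖g x‖ₑ ^ 2)
          (Continuous.measurable (by fun_prop))]
        simp

end GridAveraging

section Plancherel

variable {V E : Type*} [NormedAddCommGroup V] [InnerProductSpace ℝ V] [FiniteDimensional ℝ V]
  [MeasurableSpace V] [BorelSpace V] [NormedAddCommGroup E]

lemma continuous_fourierInv [NormedSpace ℂ E] {R : V → E} (hR : Integrable R) :
    Continuous (𝓕⁻ R) := by
  rw [← Real.Lp.fourierTransformInv_toLp (memLp_one_iff_integrable.2 hR)]
  exact map_continuous _

lemma integrable_fourierChar_smul [NormedSpace ℂ E] {α : Type*} [MeasurableSpace α]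
    [TopologicalSpace α] [OpensMeasurableSpace α] {μ : Measure α} {R : α → E} (hR : Integrable R μ)
    {φ : α → ℝ} (hφ : Continuous φ) : Integrable (fun ξ => 𝐞 (φ ξ) • R ξ) μ := by
  simp only [Circle.smul_def]
  exact hR.bdd_smul 1 (Continuous.aestronglyMeasurable (by fun_prop))
    (.of_forall fun _ => (Circle.norm_coe _).le)

lemma fourierInv_sub_apply [NormedSpace ℂ E] {R S : V → E} (hR : Integrable R) (hS : Integrable S)
    (x : V) : 𝓕⁻ (fun ξ => R ξ - S ξ) x = 𝓕⁻ R x - 𝓕⁻ S x := by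
  simp only [Real.fourierInv_eq, smul_sub]
  exact integral_sub (integrable_fourierChar_smul hR (by fun_prop))
    (integrable_fourierChar_smul hS (by fun_prop))

lemma fourierInv_finsetSum_apply [NormedSpace ℂ E] {ι : Type*} (s : Finset ι) {R : ι → V → E}
    (hR : ∀ i ∈ s, Integrable (R i)) (x : V) :
    𝓕⁻ (fun ξ => ∑ i ∈ s, R i ξ) x = ∑ i ∈ s, 𝓕⁻ (R i) x := by
  simp only [Real.fourierInv_eq, Finset.smul_sum]
  exact integral_finsetSum s fun i hi => integrable_fourierChar_smul (hR i hi) (by fun_prop)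

lemma map_fourierInv [NormedSpace ℂ E] [CompleteSpace E] {G : Type*} [NormedAddCommGroup G]
    [NormedSpace ℂ G] [CompleteSpace G] (ℓ : E →L[ℂ] G) {R : V → E} (hR : Integrable R) (x : V) :
    ℓ (𝓕⁻ R x) = 𝓕⁻ (fun ξ => ℓ (R ξ)) x := by
  simp only [Real.fourierInv_eq]
  rw [← ℓ.integral_comp_comm (integrable_fourierChar_smul hR (by fun_prop))]
  simp only [Circle.smul_def, map_smul]

lemma fourierChar_smul_fourierInv [NormedSpace ℂ E] (R : V → E) (θ x : V) :
    𝐞 (inner ℝ θ x) • 𝓕⁻ R x = 𝓕⁻ (fun ξ => R (ξ - θ)) x := by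
  simp only [Real.fourierInv_eq, Circle.smul_def]
  rw [← integral_sub_right_eq_self _ θ, ← integral_smul]
  simp only [smul_smul, ← Circle.coe_mul, ← AddChar.map_add_eq_mul, ← inner_add_left,
    add_sub_cancel]

lemma fourierInv_real_eq [NormedSpace ℂ E] (R : ℝ → E) (x : ℝ) :
    𝓕⁻ R x = ∫ ξ, 𝐞 (ξ * x) • R ξ := by
  simp [Real.fourierInv_eq, mul_comm]

lemma eLpNorm_two_sq {α G : Type*} [MeasurableSpace α] [TopologicalSpace G] [ContinuousENorm G]
    (μ : Measure α) (f : α → G) : eLpNorm f 2 μ ^ 2 = ∫⁻ x, ‖f x‖ₑ ^ 2 ∂μ := by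
  simpa using eLpNorm_nnreal_pow_eq_lintegral (f := f) (μ := μ) (p := 2) two_ne_zero

variable [InnerProductSpace ℂ E] [CompleteSpace E]

lemma integral_smul_fourierInv {R : V → E} (hR : Integrable R) (φ : 𝓢(V, ℂ)) :
    ∫ x, φ x • 𝓕⁻ R x = ∫ ξ, (𝓕⁻ φ : 𝓢(V, ℂ)) ξ • R ξ := by
  have hflip := VectorFourier.integral_fourierIntegral_smul_eq_flip (μ := volume) (ν := volume)
    (L := -innerₗ V) (f := (φ : V → ℂ)) (g := R) Real.continuous_fourierChar
    (by simp only [LinearMap.neg_apply, innerₗ_apply_apply]; exact continuous_inner.neg)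
    φ.integrable hR
  rw [show (-innerₗ V).flip = -innerₗ V by ext; simp [real_inner_comm]] at hflip
  rw [SchwartzMap.fourierInv_coe]
  exact hflip.symm

/-- Both sides represent the same tempered distribution. -/
lemma fourierInv_toLp_ae_eq {R : V → E} (h1 : Integrable R) (h2 : MemLp R 2) :
    (𝓕⁻ (h2.toLp R) : Lp E 2 (volume : Measure V)) =ᵐ[volume] 𝓕⁻ R := by
  set S : Lp E 2 (volume : Measure V) := 𝓕⁻ (h2.toLp R)
  refine ae_eq_of_integral_contDiff_smul_eq ((Lp.memLp S).locallyIntegrable one_le_two)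
    (continuous_fourierInv h1).locallyIntegrable fun g hg hgc => ?_
  let φ : 𝓢(V, ℂ) := HasCompactSupport.toSchwartzMap (f := fun x => (g x : ℂ))
    (hgc.comp_left Complex.ofReal_zero) (Complex.ofRealCLM.contDiff.comp hg)
  have hφ : ∀ x, ∀ v : E, g x • v = φ x • v := fun x v => (Complex.coe_smul (g x) v).symm
  have hdistr := congrArg (fun T => T φ) (Lp.fourierInv_toTemperedDistribution_eq (h2.toLp R))
  simp only [TemperedDistribution.fourierInv_apply, Lp.toTemperedDistribution_apply] at hdistr
  simp_rw [hφ]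
  rw [integral_smul_fourierInv h1, ← hdistr]
  exact integral_congr_ae (h2.coeFn_toLp.mono fun x hx => by simp only [hx])

theorem lintegral_fourierInv_sq {R : V → E} (h1 : Integrable R) (h2 : MemLp R 2) :
    ∫⁻ x, ‖𝓕⁻ R x‖ₑ ^ 2 = ∫⁻ ξ, ‖R ξ‖ₑ ^ 2 := by
  have h : ‖(𝓕⁻ (h2.toLp R) : Lp E 2 (volume : Measure V))‖ₑ = ‖h2.toLp R‖ₑ :=
    (Lp.fourierTransformₗᵢ V E).symm.enorm_map _
  rw [← eLpNorm_two_sq, ← eLpNorm_two_sq, ← eLpNorm_congr_ae (fourierInv_toLp_ae_eq h1 h2),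
    ← Lp.enorm_def, h, Lp.enorm_toLp]

lemma eLpNorm_fourier_toLp {f : V → E} (hf : MemLp f 2) :
    eLpNorm (𝓕 (hf.toLp f) : Lp E 2 (volume : Measure V)) 2 volume = eLpNorm f 2 volume := by
  have h : ‖(𝓕 (hf.toLp f) : Lp E 2 (volume : Measure V))‖ₑ = ‖hf.toLp f‖ₑ :=
    (Lp.fourierTransformₗᵢ V E).enorm_map _
  rwa [Lp.enorm_def, Lp.enorm_toLp] at h

lemma integral_smul_fourier_toLp {f : V → E} (hf : MemLp f 2) (ψ : 𝓢(V, ℂ)) :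
    ∫ ξ, ψ ξ • (𝓕 (hf.toLp f) : Lp E 2 (volume : Measure V)) ξ =
      ∫ y, 𝓕 (ψ : V → ℂ) y • f y := by
  have hdistr := congrArg (fun T => T ψ) (Lp.fourier_toTemperedDistribution_eq (hf.toLp f))
  simp only [TemperedDistribution.fourier_apply, Lp.toTemperedDistribution_apply] at hdistr
  rw [← hdistr, SchwartzMap.fourier_coe]
  exact integral_congr_ae (hf.coeFn_toLp.mono fun x hx => by simp only [hx])

end Plancherel

section Multipliers

/-- The Fourier multiplier of the average over the interval from `x` to `x + 1`. -/
def boxMult (η : ℝ) : ℂ := ∫ s in (0 : ℝ)..1, (𝐞 (s * η) : ℂ)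

/-- The Fourier multiplier of convolution with the tent of half-width `1`. -/
def tentMult (η : ℝ) : ℂ := boxMult (-η) * boxMult η

lemma continuous_boxMult : Continuous boxMult :=
  intervalIntegral.continuous_parametric_intervalIntegral_of_continuous'
    (by fun_prop) 0 1

lemma continuous_tentMult : Continuous tentMult :=
  (continuous_boxMult.comp continuous_neg).mul continuous_boxMult

lemma norm_boxMult_le_one (η : ℝ) : ‖boxMult η‖ ≤ 1 := by
  simpa [boxMult] using intervalIntegral.norm_integral_le_of_norm_le_const (a := 0) (b := 1)
    (f := fun s => (𝐞 (s * η) : ℂ)) (C := 1) fun _ _ => (Circle.norm_coe _).le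

lemma norm_tentMult_le (η : ℝ) : ‖tentMult η‖ ≤ ‖boxMult η‖ :=
  (norm_mul _ _).trans_le (mul_le_of_le_one_left (norm_nonneg _) (norm_boxMult_le_one _))

lemma norm_tentMult_le_one (η : ℝ) : ‖tentMult η‖ ≤ 1 :=
  (norm_tentMult_le η).trans (norm_boxMult_le_one η)

lemma norm_fourierChar_sub_one_le (t : ℝ) : ‖(𝐞 t : ℂ) - 1‖ ≤ 2 * Real.pi * |t| := by
  have h := Real.norm_exp_I_mul_ofReal_sub_one_le (x := 2 * Real.pi * t)
  rwa [Real.norm_eq_abs, abs_mul, abs_of_pos Real.two_pi_pos, mul_comm Complex.I,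
    ← Real.fourierChar_apply] at h

lemma norm_boxMult_sub_one_le (η : ℝ) : ‖boxMult η - 1‖ ≤ 2 * Real.pi * |η| := by
  have hsub : boxMult η - 1 = ∫ s in (0 : ℝ)..1, ((𝐞 (s * η) : ℂ) - 1) := by
    rw [intervalIntegral.integral_sub
      (Continuous.intervalIntegrable (by fun_prop) _ _) (by simp), boxMult]
    simp
  rw [hsub]
  refine (intervalIntegral.norm_integral_le_of_norm_le_const (C := 2 * Real.pi * |η|)
    fun s hs => ?_).trans_eq (by simp)
  rw [Set.uIoc_of_le zero_le_one] at hs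
  refine (norm_fourierChar_sub_one_le _).trans ?_
  rw [abs_mul, abs_of_pos hs.1]
  exact mul_le_mul_of_nonneg_left (mul_le_of_le_one_left (abs_nonneg η) hs.2) Real.two_pi_pos.le

lemma half_le_norm_boxMult {η : ℝ} (hη : |η| ≤ 1 / 16) : 1 / 2 ≤ ‖boxMult η‖ := by
  have hdiff := norm_boxMult_sub_one_le η
  have htri := norm_sub_norm_le 1 (boxMult η)
  rw [norm_one, norm_sub_rev] at htri
  nlinarith [Real.pi_lt_four, abs_nonneg η]

lemma two_pi_I_mul_boxMult (η : ℝ) : 2 * Real.pi * Complex.I * η * boxMult η = 𝐞 η - 1 := by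
  rcases eq_or_ne η 0 with rfl | hη
  · simp
  have hc : (2 * Real.pi * Complex.I * η : ℂ) ≠ 0 := by simp [Real.pi_ne_zero, hη]
  have h := integral_exp_mul_complex (a := 0) (b := 1) hc
  have hexp : ∀ s : ℝ, (𝐞 (s * η) : ℂ) = Complex.exp (2 * Real.pi * Complex.I * η * s) := by
    intro s
    rw [Real.fourierChar_apply]
    push_cast
    ring_nf
  rw [boxMult]
  simp_rw [hexp]
  rw [h, mul_div_cancel₀ _ hc, ← one_mul η, hexp]
  simp

lemma norm_boxMult_mul_le (η : ℝ) : ‖boxMult η‖ * |η| ≤ 1 / 2 := by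
  have h := congrArg norm (two_pi_I_mul_boxMult η)
  have h2 : ‖(𝐞 η : ℂ) - 1‖ ≤ 2 := (norm_sub_le _ _).trans (by
    rw [Circle.norm_coe, norm_one, one_add_one_eq_two])
  simp only [norm_mul, Complex.norm_ofNat, Complex.norm_real, Real.norm_eq_abs, Complex.norm_I,
    abs_of_pos Real.pi_pos, mul_one] at h
  have hpos : 0 ≤ ‖boxMult η‖ * |η| := by positivity
  nlinarith [Real.pi_gt_three]

lemma norm_tentMult_sub_one_le (η : ℝ) : ‖tentMult η - 1‖ ≤ 4 * Real.pi * |η| := by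
  have hneg := norm_boxMult_sub_one_le (-η)
  rw [abs_neg] at hneg
  calc ‖tentMult η - 1‖ = ‖(boxMult (-η) - 1) * boxMult η + (boxMult η - 1)‖ := by
        rw [tentMult]; ring_nf
    _ ≤ ‖boxMult (-η) - 1‖ * 1 + ‖boxMult η - 1‖ := by
        refine (norm_add_le _ _).trans ?_
        rw [norm_mul]
        gcongr
        exact norm_boxMult_le_one η
    _ ≤ 4 * Real.pi * |η| := by linarith [norm_boxMult_sub_one_le η]

section Averages

variable {E : Type*} [NormedAddCommGroup E] [NormedSpace ℂ E]

lemma integrable_mult_smul {G : ℝ → E} (hG : Integrable G) {m : ℝ → ℂ} (hm : Continuous m)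
    {A : ℝ} (hA : ∀ η, ‖m η‖ ≤ A) (T : ℝ) : Integrable fun ξ => m (T * ξ) • G ξ :=
  hG.bdd_smul A (Continuous.aestronglyMeasurable (by fun_prop)) (.of_forall fun _ => hA _)

variable [CompleteSpace E]

lemma segmentAvg_fourierInv {G : ℝ → E} (hG : Integrable G) (T a : ℝ) :
    segmentAvg (𝓕⁻ G) T a = 𝓕⁻ (fun ξ => boxMult (T * ξ) • G ξ) a := by
  simp_rw [segmentAvg, fourierInv_real_eq]
  rw [intervalIntegral_integral_swap]
  · refine integral_congr_ae (.of_forall fun ξ => ?_)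
    have hchar : ∀ s, 𝐞 (ξ * (a + T * s)) • G ξ =
        (𝐞 (s * (T * ξ)) : ℂ) • 𝐞 (ξ * a) • G ξ := by
      intro s
      simp only [Circle.smul_def, smul_smul, ← Circle.coe_mul, ← AddChar.map_add_eq_mul]
      ring_nf
    simp only [hchar]
    rw [intervalIntegral.integral_smul_const, ← boxMult, smul_comm]
  · rw [Set.uIoc_of_le zero_le_one]
    exact integrable_fourierChar_smul (φ := fun p : ℝ × ℝ => p.2 * (a + T * p.1))
      (hG.comp_snd _) (by fun_prop)

lemma tentAvg_fourierInv {G : ℝ → E} (hG : Integrable G) (T x : ℝ) :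
    tentAvg (𝓕⁻ G) T x = 𝓕⁻ (fun ξ => tentMult (T * ξ) • G ξ) x := by
  have htent : tentAvg (𝓕⁻ G) T x = segmentAvg (segmentAvg (𝓕⁻ G) T) (-T) x := by
    simp only [tentAvg, segmentAvg, neg_mul, ← sub_eq_add_neg]
  have hbox : segmentAvg (𝓕⁻ G) T = 𝓕⁻ fun ξ => boxMult (T * ξ) • G ξ :=
    funext (segmentAvg_fourierInv hG T)
  rw [htent, hbox, segmentAvg_fourierInv
    (integrable_mult_smul hG continuous_boxMult norm_boxMult_le_one T)]
  simp only [tentMult, smul_smul, neg_mul]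

end Averages

/-- A low-pass multiplier with transition band `1 / 4 < |η| ≤ 1 / 2`: the properties of `χ̂` on
which the maximal inequality depends. -/
structure IsLowPass (m : ℝ → ℂ) : Prop where
  eq_one {η : ℝ} : |η| ≤ 1 / 4 → m η = 1
  eq_zero {η : ℝ} : 1 / 2 < |η| → m η = 0
  norm_le_one (η : ℝ) : ‖m η‖ ≤ 1

lemma IsAdmissible.isLowPass {χ : 𝓢(ℝ, ℂ)} (hχ : IsAdmissible χ) :
    IsLowPass (𝓕 (χ : ℝ → ℂ)) := by
  have hnonneg : ∀ ξ, 0 ≤ (𝓕 (χ : ℝ → ℂ) ξ).re := fun ξ =>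
    (Set.indicator_nonneg (fun _ _ => zero_le_one) ξ).trans (hχ ξ).2.1
  refine ⟨fun {ξ} h => ?_, fun {ξ} h => ?_, fun ξ => ?_⟩ <;> obtain ⟨him, hlow, hup⟩ := hχ ξ
  · obtain ⟨h1, h2⟩ := abs_le.1 h
    rw [Set.indicator_of_mem (Set.mem_Icc.2 ⟨by linarith, h2⟩)] at hlow
    rw [Set.indicator_of_mem (Set.mem_Icc.2 ⟨by linarith, by linarith⟩)] at hup
    exact Complex.ext (le_antisymm hup hlow) him
  · rw [Set.indicator_of_notMem
      fun h' => absurd (abs_le.2 ⟨by linarith [h'.1], h'.2⟩) (not_le.2 h)] at hup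
    exact Complex.ext (le_antisymm hup (hnonneg ξ)) him
  · rw [← Complex.abs_re_eq_norm.2 him, abs_of_nonneg (hnonneg ξ)]
    exact hup.trans (Set.indicator_le_self' (fun _ _ => zero_le_one) ξ)

lemma IsLowPass.hasCompactSupport {m : ℝ → ℂ} (hm : IsLowPass m) : HasCompactSupport m :=
  .intro (isCompact_Icc (a := -1 / 2) (b := 1 / 2)) fun η hη => hm.eq_zero <| by
    by_contra! h
    exact hη ⟨by linarith [(abs_le.1 h).1], (abs_le.1 h).2⟩

lemma IsLowPass.norm_sub_tentMult_mul_le {m : ℝ → ℂ} (hm : IsLowPass m) (η : ℝ) :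
    ‖m η - tentMult η‖ * |η| ≤ 1 := by
  have hm2 : ‖m η‖ * |η| ≤ 1 / 2 := by
    rcases le_or_gt |η| (1 / 2) with h | h
    · exact (mul_le_of_le_one_left (abs_nonneg η) (hm.norm_le_one η)).trans h
    · simp [hm.eq_zero h]
  calc ‖m η - tentMult η‖ * |η| ≤ (‖m η‖ + ‖boxMult η‖) * |η| := by
        gcongr
        exact (norm_sub_le _ _).trans (add_le_add_right (norm_tentMult_le η) _)
    _ ≤ 1 := by linarith [norm_boxMult_mul_le η]

lemma IsLowPass.norm_sub_tentMult_le {m : ℝ → ℂ} (hm : IsLowPass m) (η : ℝ) :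
    ‖m η - tentMult η‖ ≤ 16 * |η| := by
  rcases le_or_gt |η| (1 / 4) with h | h
  · rw [hm.eq_one h, norm_sub_rev]
    nlinarith [norm_tentMult_sub_one_le η, Real.pi_lt_d2, abs_nonneg η]
  · nlinarith [hm.norm_sub_tentMult_mul_le η, norm_nonneg (m η - tentMult η)]

/-- The right-hand side telescopes when summed over `η = 2 ^ k * ξ`. -/
lemma sq_le_mul_sub_of_mul_le {r η A B : ℝ} (hr : 0 ≤ r) (hA : r ≤ A * |η|) (hB : r * |η| ≤ B) :
    r ^ 2 ≤ (A + 2 * B) ^ 2 * ((2 * η) ^ 2 / (1 + (2 * η) ^ 2) - η ^ 2 / (1 + η ^ 2)) := by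
  have hdiff : (2 * η) ^ 2 / (1 + (2 * η) ^ 2) - η ^ 2 / (1 + η ^ 2) =
      3 * η ^ 2 / ((1 + η ^ 2) * (1 + 4 * η ^ 2)) := by
    field_simp
    ring
  rw [hdiff, ← sq_abs η, mul_div_assoc', le_div_iff₀ (by positivity)]
  set s := |η|
  have hs : 0 ≤ s := abs_nonneg η
  have hB0 : 0 ≤ B := (mul_nonneg hr hs).trans hB
  have h1 : r ^ 2 ≤ (A * s) ^ 2 := pow_le_pow_left₀ hr hA 2
  have h2 : (r * s) ^ 2 ≤ A * s * (B * s) := by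
    nlinarith [mul_le_mul hA hB (mul_nonneg hr hs) (hr.trans hA)]
  have h3 : (r * s) ^ 2 * s ^ 2 ≤ B ^ 2 * s ^ 2 := by
    gcongr
  nlinarith [mul_nonneg (sq_nonneg s) (sq_nonneg (A + 2 * B)), mul_nonneg (sq_nonneg s)
    (sq_nonneg (A + B)), mul_nonneg (sq_nonneg s) (sq_nonneg (A - B)), mul_nonneg hB0 hB0]

lemma tsum_enorm_comp_two_pow_mul_sq_le {E : Type*} [SeminormedAddCommGroup E] {d : ℝ → E}
    {A B : ℝ} (hA : ∀ η, ‖d η‖ ≤ A * |η|) (hB : ∀ η, ‖d η‖ * |η| ≤ B) (ξ : ℝ) :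
    ∑' k : ℕ, ‖d (2 ^ k * ξ)‖ₑ ^ 2 ≤ ENNReal.ofReal ((A + 2 * B) ^ 2) := by
  refine ENNReal.tsum_le_of_sum_range_le fun K => ?_
  simp_rw [← ofReal_norm, ← ENNReal.ofReal_pow (norm_nonneg _)]
  rw [← ENNReal.ofReal_sum_of_nonneg fun _ _ => by positivity]
  set u : ℕ → ℝ := fun k => (2 ^ k * ξ) ^ 2 / (1 + (2 ^ k * ξ) ^ 2)
  have hu : u K - u 0 ≤ 1 := by
    have h0 : 0 ≤ u 0 := by positivity
    have hK : u K ≤ 1 := div_le_one_of_le₀ (by linarith) (by positivity)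
    linarith
  refine ENNReal.ofReal_le_ofReal ?_
  calc ∑ k ∈ Finset.range K, ‖d (2 ^ k * ξ)‖ ^ 2
      ≤ ∑ k ∈ Finset.range K, (A + 2 * B) ^ 2 * (u (k + 1) - u k) := by
        refine Finset.sum_le_sum fun k _ => ?_
        have h := sq_le_mul_sub_of_mul_le (norm_nonneg _) (hA (2 ^ k * ξ)) (hB (2 ^ k * ξ))
        rwa [← mul_assoc, ← pow_succ'] at h
    _ = (A + 2 * B) ^ 2 * (u K - u 0) := by rw [← Finset.mul_sum, Finset.sum_range_sub]
    _ ≤ (A + 2 * B) ^ 2 := mul_le_of_le_one_right (sq_nonneg _) hu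

end Multipliers

section ExponentialSums

variable {ι : Type*}

/-- The frequencies of a function `F` within distance `1 / 2` of each `θ n`, moved to the origin
and collected in one vector. -/
def bands (F : ℝ → ℂ) (θ : ι → ℝ) : ℝ → EuclideanSpace ℂ ι :=
  (Set.Icc (-1 / 2 : ℝ) (1 / 2)).indicator fun ξ => WithLp.toLp 2 fun n => F (ξ + θ n)

lemma bands_eq_zero (F : ℝ → ℂ) (θ : ι → ℝ) {ξ : ℝ} (h : 1 / 2 < |ξ|) : bands F θ ξ = 0 :=
  Set.indicator_of_notMem
    (fun h' => absurd (abs_le.2 ⟨by linarith [h'.1], h'.2⟩) (not_le.2 h)) _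

lemma bands_apply (F : ℝ → ℂ) (θ : ι → ℝ) {ξ : ℝ} (h : |ξ| ≤ 1 / 2) (n : ι) :
    bands F θ ξ n = F (ξ + θ n) := by
  obtain ⟨h1, h2⟩ := abs_le.1 h
  rw [bands, Set.indicator_of_mem (Set.mem_Icc.2 ⟨by linarith, h2⟩)]

variable [Fintype ι]

/-- The exponential sum `∑ n, e(θ n x) v n`, as a functional of its coefficient vector `v`. -/
def expSum (θ : ι → ℝ) (x : ℝ) : EuclideanSpace ℂ ι →L[ℂ] ℂ :=
  ∑ n, (𝐞 (θ n * x) : ℂ) • EuclideanSpace.proj n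

lemma expSum_apply (θ : ι → ℝ) (x : ℝ) (v : EuclideanSpace ℂ ι) :
    expSum θ x v = ∑ n, 𝐞 (θ n * x) • v n := by
  simp [expSum, Circle.smul_def]

lemma continuous_expSum (θ : ι → ℝ) : Continuous (expSum θ) :=
  continuous_finsetSum _ fun n _ => Continuous.smul
    (f := fun x => (𝐞 (θ n * x) : ℂ)) (by fun_prop) continuous_const

lemma norm_expSum_apply_le (θ : ι → ℝ) (x : ℝ) (v : EuclideanSpace ℂ ι) :
    ‖expSum θ x v‖ ≤ Fintype.card ι * ‖v‖ := by
  rw [expSum_apply]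
  calc ‖∑ n, 𝐞 (θ n * x) • v n‖ ≤ ∑ _n : ι, ‖v‖ := norm_sum_le_of_le _ fun n _ =>
        (Circle.norm_smul _ _).trans_le (PiLp.norm_apply_le v n)
    _ = Fintype.card ι * ‖v‖ := by simp

lemma enorm_sq_eq_sum (v : EuclideanSpace ℂ ι) : ‖v‖ₑ ^ 2 = ∑ n, ‖v n‖ₑ ^ 2 := by
  simp_rw [← ofReal_norm, ← ENNReal.ofReal_pow (norm_nonneg _)]
  rw [EuclideanSpace.norm_sq_eq, ENNReal.ofReal_sum_of_nonneg fun _ _ => by positivity]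

lemma exists_forall_ne_half_lt_abs_sub {κ : Type*} [Finite κ] [Nonempty κ]
    {θ : κ → ℝ} (hθ : Pairwise fun i j => 1 < |θ i - θ j|) (ξ : ℝ) :
    ∃ n, ∀ j, j ≠ n → 1 / 2 < |ξ - θ j| := by
  obtain ⟨n, hn⟩ := Finite.exists_min fun n => |ξ - θ n|
  refine ⟨n, fun j hj => ?_⟩
  have htri := (hθ hj).trans_le (abs_sub_le (θ j) ξ (θ n))
  rw [abs_sub_comm (θ j)] at htri
  linarith [hn j]

lemma expSum_fourierInv_eq_sum (θ : ι → ℝ) {G : ℝ → EuclideanSpace ℂ ι} (hG : Integrable G)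
    (x : ℝ) : expSum θ x (𝓕⁻ G x) = ∑ n, 𝓕⁻ (fun ξ => G (ξ - θ n) n) x := by
  rw [expSum_apply]
  refine Finset.sum_congr rfl fun n _ => ?_
  have hcoord : 𝓕⁻ G x n = 𝓕⁻ (fun ξ => G ξ n) x := map_fourierInv (EuclideanSpace.proj n) hG x
  have hchar : 𝐞 (θ n * x) = 𝐞 (inner ℝ (θ n) x) := by simp [mul_comm]
  rw [hcoord, hchar, fourierChar_smul_fourierInv (fun ξ => G ξ n)]

lemma expSum_fourierInv (θ : ι → ℝ) {G : ℝ → EuclideanSpace ℂ ι} (hG : Integrable G) (x : ℝ) :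
    expSum θ x (𝓕⁻ G x) = 𝓕⁻ (fun ξ => ∑ n, G (ξ - θ n) n) x := by
  rw [expSum_fourierInv_eq_sum θ hG,
    fourierInv_finsetSum_apply _ fun n _ => (hG.eval_piLp n).comp_sub_right (θ n)]

lemma lintegral_enorm_sq_eq_lintegral_sum (θ : ι → ℝ) {G : ℝ → EuclideanSpace ℂ ι}
    (hG : AEStronglyMeasurable G) :
    ∫⁻ ξ, ‖G ξ‖ₑ ^ 2 = ∫⁻ ξ, ∑ n, ‖G (ξ - θ n) n‖ₑ ^ 2 := by
  have hmeas : ∀ n, AEMeasurable fun ξ => ‖G ξ n‖ₑ ^ 2 := fun n =>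
    ((EuclideanSpace.proj (𝕜 := ℂ) n).continuous.comp_aestronglyMeasurable hG).enorm.pow_const 2
  have hshift : ∀ n, AEMeasurable fun ξ => ‖G (ξ - θ n) n‖ₑ ^ 2 := fun n =>
    (hmeas n).comp_quasiMeasurePreserving
      (measurePreserving_sub_right volume (θ n)).quasiMeasurePreserving
  rw [lintegral_finsetSum' _ fun n _ => hshift n]
  simp_rw [enorm_sq_eq_sum]
  rw [lintegral_finsetSum' _ fun n _ => hmeas n]
  exact Finset.sum_congr rfl fun n _ =>
    (lintegral_sub_right_eq_self (fun ξ => ‖G ξ n‖ₑ ^ 2) (θ n)).symm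

/-- After modulation by the frequencies the components of `G` have disjoint supports. -/
theorem lintegral_expSum_fourierInv_sq {θ : ι → ℝ} (hθ : Pairwise fun i j => 1 < |θ i - θ j|)
    {G : ℝ → EuclideanSpace ℂ ι} (h1 : Integrable G) (h2 : MemLp G 2)
    (hsupp : ∀ ξ, 1 / 2 < |ξ| → G ξ = 0) :
    ∫⁻ x, ‖expSum θ x (𝓕⁻ G x)‖ₑ ^ 2 = ∫⁻ ξ, ‖G ξ‖ₑ ^ 2 := by
  have hint : Integrable fun ξ => ∑ n, G (ξ - θ n) n :=
    integrable_finsetSum _ fun n _ => (h1.eval_piLp n).comp_sub_right (θ n)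
  have hmem : MemLp (fun ξ => ∑ n, G (ξ - θ n) n) 2 :=
    memLp_finsetSum _ fun n _ =>
      (h2.eval_piLp n).comp_measurePreserving (measurePreserving_sub_right volume (θ n))
  simp_rw [expSum_fourierInv θ h1]
  rw [lintegral_fourierInv_sq hint hmem, lintegral_enorm_sq_eq_lintegral_sum θ h1.1]
  refine lintegral_congr fun ξ => ?_
  rcases isEmpty_or_nonempty ι with hι | hι
  · simp
  obtain ⟨n, hn⟩ := exists_forall_ne_half_lt_abs_sub hθ ξ
  have hzero : ∀ j, j ≠ n → G (ξ - θ j) j = 0 := fun j hj => by simp [hsupp _ (hn j hj)]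
  rw [Fintype.sum_eq_single n hzero, Fintype.sum_eq_single n fun j hj => by simp [hzero j hj]]

lemma fourierInv_indicator_fourierChar_smul {E : Type*} [NormedAddCommGroup E] [NormedSpace ℂ E]
    [CompleteSpace E] {δ : ℝ} (hδ : 0 ≤ δ) (b : ℝ) (v : E) (x : ℝ) :
    𝓕⁻ ((Set.Ioc 0 δ).indicator fun ξ => 𝐞 (-(ξ * b)) • v) x =
      (δ * boxMult (δ * (x - b))) • v := by
  have hind : ∀ ξ, 𝐞 (ξ * x) • (Set.Ioc 0 δ).indicator (fun ξ => 𝐞 (-(ξ * b)) • v) ξ =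
      (Set.Ioc 0 δ).indicator (fun ξ => (𝐞 (ξ * (x - b)) : ℂ) • v) ξ := by
    intro ξ
    rw [Set.indicator_apply, Set.indicator_apply]
    split_ifs
    · rw [smul_smul, ← AddChar.map_add_eq_mul, Circle.smul_def]
      ring_nf
    · exact smul_zero _
  have hscale : (δ : ℂ) * boxMult (δ * (x - b)) = ∫ ξ in (0 : ℝ)..δ, (𝐞 (ξ * (x - b)) : ℂ) := by
    have h := intervalIntegral.smul_integral_comp_mul_left (a := 0) (b := 1)
      (fun ξ => (𝐞 (ξ * (x - b)) : ℂ)) δ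
    rw [mul_zero, mul_one, Complex.real_smul] at h
    simp only [← h, boxMult, mul_left_comm, mul_assoc]
  simp_rw [fourierInv_real_eq, hind]
  rw [integral_indicator measurableSet_Ioc, ← intervalIntegral.integral_of_le hδ,
    intervalIntegral.integral_smul_const, hscale]

/-- A large sieve inequality. On `[b, b + 1)` the vector `v` is dominated by the inverse Fourier
transform of a short bump of height `v`, to which orthogonality applies. -/
theorem setLIntegral_expSum_sq_le {θ : ι → ℝ} (hθ : Pairwise fun i j => 1 < |θ i - θ j|) (b : ℝ)
    (v : EuclideanSpace ℂ ι) :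
    ∫⁻ x in Set.Ico b (b + 1), ‖expSum θ x v‖ₑ ^ 2 ≤ 64 * ‖v‖ₑ ^ 2 := by
  set G := (Set.Ioc 0 (1 / 16 : ℝ)).indicator fun ξ => 𝐞 (-(ξ * b)) • v with hGdef
  have hbdd : ∀ p, MemLp G p := fun p => by
    have hcont : Continuous fun ξ : ℝ => 𝐞 (-(ξ * b)) • v := by fun_prop
    refine (memLp_indicator_iff_restrict measurableSet_Ioc).2 ?_
    exact .of_bound hcont.aestronglyMeasurable ‖v‖ (.of_forall fun _ => (Circle.norm_smul _ _).le)
  have hsupp : ∀ ξ, 1 / 2 < |ξ| → G ξ = 0 := fun ξ hξ =>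
    Set.indicator_of_notMem (fun h => by rw [abs_of_pos h.1] at hξ; linarith [h.2]) _
  have hlow : ∀ x ∈ Set.Ico b (b + 1), ‖expSum θ x v‖ₑ ^ 2 ≤
      32 ^ 2 * ‖expSum θ x (𝓕⁻ G x)‖ₑ ^ 2 := by
    intro x hx
    have hbox := half_le_norm_boxMult (η := 1 / 16 * (x - b))
      (abs_le.2 ⟨by linarith [hx.1], by linarith [hx.2]⟩)
    rw [hGdef, fourierInv_indicator_fourierChar_smul (by norm_num), map_smul, ← mul_pow]
    refine pow_le_pow_left' ?_ 2
    rw [← ofReal_norm, ← ofReal_norm, show (32 : ℝ≥0∞) = ENNReal.ofReal 32 by simp,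
      ← ENNReal.ofReal_mul (by norm_num)]
    refine ENNReal.ofReal_le_ofReal ?_
    rw [norm_smul, norm_mul, Complex.norm_real, Real.norm_of_nonneg (by norm_num)]
    nlinarith [norm_nonneg (expSum θ x v)]
  calc ∫⁻ x in Set.Ico b (b + 1), ‖expSum θ x v‖ₑ ^ 2
      ≤ ∫⁻ x in Set.Ico b (b + 1), 32 ^ 2 * ‖expSum θ x (𝓕⁻ G x)‖ₑ ^ 2 :=
        setLIntegral_mono' measurableSet_Ico hlow
    _ ≤ 32 ^ 2 * ∫⁻ x, ‖expSum θ x (𝓕⁻ G x)‖ₑ ^ 2 := by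
        rw [← lintegral_const_mul' _ _ (by finiteness)]
        exact setLIntegral_le_lintegral _ _
    _ = 32 ^ 2 * ∫⁻ ξ, (Set.Ioc 0 (1 / 16 : ℝ)).indicator (fun _ => ‖v‖ₑ ^ 2) ξ := by
        rw [lintegral_expSum_fourierInv_sq hθ (memLp_one_iff_integrable.1 (hbdd 1)) (hbdd 2) hsupp]
        congr 2 with ξ
        rw [hGdef, Set.indicator_apply, Set.indicator_apply]
        split_ifs <;> simp [← ofReal_norm]
    _ = 64 * ‖v‖ₑ ^ 2 := by
        rw [lintegral_indicator_const measurableSet_Ioc, Real.volume_Ioc, mul_left_comm,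
          show (32 : ℝ≥0∞) ^ 2 = ENNReal.ofReal (32 ^ 2) by norm_num,
          ← ENNReal.ofReal_mul (by norm_num), mul_comm]
        norm_num

lemma memLp_bands {F : ℝ → ℂ} (hF : MemLp F 2) (θ : ι → ℝ) : MemLp (bands F θ) 2 :=
  MemLp.indicator measurableSet_Icc <| .of_eval_piLp fun n =>
    hF.comp_measurePreserving (measurePreserving_add_right volume (θ n))

lemma integrable_bands {F : ℝ → ℂ} (hF : MemLp F 2) (θ : ι → ℝ) : Integrable (bands F θ) := by
  have hon : IntegrableOn (bands F θ) (Set.Icc (-1 / 2) (1 / 2)) :=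
    ((memLp_bands hF θ).restrict _).integrable one_le_two
  exact hon.integrable_of_forall_notMem_eq_zero fun ξ hξ => Set.indicator_of_notMem hξ _

lemma lintegral_bands_sq_le {θ : ι → ℝ} (hθ : Pairwise fun i j => 1 < |θ i - θ j|) {F : ℝ → ℂ}
    (hF : MemLp F 2) : ∫⁻ ξ, ‖bands F θ ξ‖ₑ ^ 2 ≤ ∫⁻ ξ, ‖F ξ‖ₑ ^ 2 := by
  rw [lintegral_enorm_sq_eq_lintegral_sum θ (memLp_bands hF θ).1]
  refine lintegral_mono fun ξ => ?_
  rcases isEmpty_or_nonempty ι with hι | hι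
  · simp
  obtain ⟨n, hn⟩ := exists_forall_ne_half_lt_abs_sub hθ ξ
  rw [Fintype.sum_eq_single n fun j hj => by simp [bands_eq_zero F θ (hn j hj)]]
  rcases le_or_gt |ξ - θ n| (1 / 2) with h | h
  · rw [bands_apply F θ h, sub_add_cancel]
  · simp [bands_eq_zero F θ h]

lemma tsum_lintegral_expSum_fourierInv_sq_le {θ : ι → ℝ}
    (hθ : Pairwise fun i j => 1 < |θ i - θ j|) {G : ℝ → EuclideanSpace ℂ ι} (h1 : Integrable G)
    (h2 : MemLp G 2) (hsupp : ∀ ξ, 1 / 2 < |ξ| → G ξ = 0) {d : ℕ → ℝ → ℂ}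
    (hd : ∀ k, Continuous (d k)) {S : ℝ≥0} (hS : ∀ ξ, ∑' k, ‖d k ξ‖ₑ ^ 2 ≤ S) :
    ∑' k, ∫⁻ x, ‖expSum θ x (𝓕⁻ (fun ξ => d k ξ • G ξ) x)‖ₑ ^ 2 ≤
      S * ∫⁻ ξ, ‖G ξ‖ₑ ^ 2 := by
  have hbound : ∀ k ξ, ‖d k ξ‖ ≤ √S := fun k ξ => by
    have h := (ENNReal.le_tsum k).trans (hS ξ)
    rw [enorm_eq_nnnorm] at h
    exact Real.le_sqrt_of_sq_le (by exact_mod_cast h)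
  have hmeas : ∀ k, AEMeasurable fun ξ => ‖d k ξ • G ξ‖ₑ ^ 2 := fun k =>
    ((hd k).aestronglyMeasurable.smul h1.1).enorm.pow_const 2
  have horth : ∀ k, ∫⁻ x, ‖expSum θ x (𝓕⁻ (fun ξ => d k ξ • G ξ) x)‖ₑ ^ 2 =
      ∫⁻ ξ, ‖d k ξ • G ξ‖ₑ ^ 2 := fun k =>
    lintegral_expSum_fourierInv_sq hθ
      (h1.bdd_smul √S (hd k).aestronglyMeasurable (.of_forall (hbound k)))
      (h2.of_le_mul ((hd k).aestronglyMeasurable.smul h1.1) (.of_forall fun ξ =>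
        (norm_smul_le _ _).trans (mul_le_mul_of_nonneg_right (hbound k ξ) (norm_nonneg _))))
      fun ξ hξ => by rw [hsupp ξ hξ, smul_zero]
  simp_rw [horth]
  rw [← lintegral_tsum hmeas, ← lintegral_const_mul' _ _ ENNReal.coe_ne_top]
  refine lintegral_mono fun ξ => ?_
  simp_rw [enorm_smul, mul_pow]
  rw [ENNReal.tsum_mul_right]
  gcongr
  exact hS ξ

end ExponentialSums

section Reduction

lemma fourierInv_comp_mul_left {E : Type*} [NormedAddCommGroup E] [NormedSpace ℂ E] {c : ℝ}
    (hc : c ≠ 0) (R : ℝ → E) (x : ℝ) : 𝓕⁻ (fun ξ => R (c * ξ)) x = |c⁻¹| • 𝓕⁻ R (c⁻¹ * x) := by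
  simp only [fourierInv_real_eq]
  rw [← Measure.integral_comp_mul_left _ c]
  refine integral_congr_ae (.of_forall fun ξ => ?_)
  simp only [mul_comm c ξ, mul_assoc, mul_inv_cancel_left₀ hc]

lemma fourier_fourierChar_smul {E : Type*} [NormedAddCommGroup E] [NormedSpace ℂ E] (R : ℝ → E)
    (x y : ℝ) : 𝓕 (fun ξ => 𝐞 (ξ * x) • R ξ) y = 𝓕⁻ R (x - y) := by
  rw [fourierInv_real_eq, Real.fourier_real_eq]
  refine integral_congr_ae (.of_forall fun ξ => ?_)
  simp only [smul_smul, ← AddChar.map_add_eq_mul]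
  ring_nf

lemma contDiff_fourier_schwartz (χ : 𝓢(ℝ, ℂ)) : ContDiff ℝ (⊤ : ℕ∞) (𝓕 (χ : ℝ → ℂ)) := by
  rw [← SchwartzMap.fourier_coe]
  exact (𝓕 χ : 𝓢(ℝ, ℂ)).smooth ⊤

lemma fourierInv_fourier_comp_eq_modulate (χ : 𝓢(ℝ, ℂ)) (k : ℕ) (θ x : ℝ) :
    𝓕⁻ (fun ξ => 𝓕 (χ : ℝ → ℂ) (2 ^ k * (ξ - θ))) x = modulate θ (dil k χ) x := by
  have hinv : 𝓕⁻ (𝓕 (χ : ℝ → ℂ)) = χ := by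
    rw [← SchwartzMap.fourier_coe, ← SchwartzMap.fourierInv_coe,
      FourierTransform.fourierInv_fourier_eq]
  rw [← fourierChar_smul_fourierInv (fun ξ => 𝓕 (χ : ℝ → ℂ) (2 ^ k * ξ)),
    fourierInv_comp_mul_left (by positivity), hinv, modulate, dil, Circle.smul_def,
    Real.fourierChar_apply, abs_of_pos (by positivity), Complex.real_smul, smul_eq_mul]
  simp [mul_comm, mul_left_comm]

variable {f : ℝ → ℂ} (hf : MemLp f 2)
include hf

lemma modulate_dil_convolution_eq {χ : 𝓢(ℝ, ℂ)} (hχ : HasCompactSupport (𝓕 (χ : ℝ → ℂ)))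
    (k : ℕ) (θ x : ℝ) :
    (modulate θ (dil k χ) ⋆[ContinuousLinearMap.mul ℂ ℂ, volume] f) x =
      𝓕⁻ (fun ξ => 𝓕 (χ : ℝ → ℂ) (2 ^ k * (ξ - θ)) *
        (𝓕 (hf.toLp f) : Lp ℂ 2 (volume : Measure ℝ)) ξ) x := by
  have hk : (2 : ℝ) ^ k ≠ 0 := by positivity
  have hchar : ContDiff ℝ (⊤ : ℕ∞) fun ξ : ℝ => (𝐞 (ξ * x) : ℂ) := by
    simp only [Real.fourierChar_apply]
    exact ((Complex.ofRealCLM.contDiff.comp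
      (contDiff_const.mul (contDiff_id.mul contDiff_const))).mul contDiff_const).cexp
  let ψ : 𝓢(ℝ, ℂ) := HasCompactSupport.toSchwartzMap
    (f := fun ξ => 𝐞 (ξ * x) • 𝓕 (χ : ℝ → ℂ) (2 ^ k * (ξ - θ)))
    (hχ.comp_homeomorph ((Homeomorph.subRight θ).trans (Homeomorph.mulLeft₀ _ hk))).smul_left
    (hchar.smul ((contDiff_fourier_schwartz χ).comp (f := fun ξ => 2 ^ k * (ξ - θ)) (by fun_prop)))
  have hψ : ∀ y, 𝓕 (ψ : ℝ → ℂ) y = modulate θ (dil k χ) (x - y) := fun y => by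
    rw [← fourierInv_fourier_comp_eq_modulate, ← fourier_fourierChar_smul]
    rfl
  rw [convolution_def, ← integral_sub_left_eq_self _ volume x, fourierInv_real_eq]
  simp only [sub_sub_cancel, ContinuousLinearMap.mul_apply', ← hψ, ← smul_eq_mul]
  rw [← integral_smul_fourier_toLp hf ψ]
  exact integral_congr_ae (.of_forall fun ξ => smul_assoc _ _ _)

lemma Xi_eq_expSum_fourierInv {χ : 𝓢(ℝ, ℂ)} (hχ : IsLowPass (𝓕 (χ : ℝ → ℂ))) {N : ℕ}
    (θ : Fin N → ℝ) (k : ℕ) (x : ℝ) :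
    Xi χ θ k f x = expSum θ x (𝓕⁻ (fun ξ => 𝓕 (χ : ℝ → ℂ) (2 ^ k * ξ) •
      bands (𝓕 (hf.toLp f) : Lp ℂ 2 (volume : Measure ℝ)) θ ξ) x) := by
  rw [expSum_fourierInv_eq_sum θ (integrable_mult_smul (integrable_bands (Lp.memLp _) θ)
    (contDiff_fourier_schwartz χ).continuous hχ.norm_le_one _), Xi]
  refine Finset.sum_congr rfl fun n _ => ?_
  rw [modulate_dil_convolution_eq hf hχ.hasCompactSupport]
  refine congrArg (fun R : ℝ → ℂ => 𝓕⁻ R x) (funext fun ξ => ?_)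
  rw [PiLp.smul_apply, smul_eq_mul]
  rcases le_or_gt |ξ - θ n| (1 / 2) with h | h
  · rw [bands_apply _ _ h, sub_add_cancel]
  · have hscaled : 1 / 2 < |2 ^ k * (ξ - θ n)| := by
      rw [abs_mul, abs_of_pos (by positivity)]
      exact h.trans_le (le_mul_of_one_le_left (abs_nonneg _) (one_le_pow₀ one_le_two))
    rw [hχ.eq_zero hscaled, zero_mul, zero_mul]

end Reduction

section MaximalInequality

lemma enorm_add_sq_le {E : Type*} [NormedAddCommGroup E] (v w : E) :
    ‖v + w‖ₑ ^ 2 ≤ 2 * ‖v‖ₑ ^ 2 + 2 * ‖w‖ₑ ^ 2 := by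
  have h := ENNReal.rpow_add_le_mul_rpow_add_rpow ‖v‖ₑ ‖w‖ₑ (p := 2) one_le_two
  norm_num [mul_add] at h
  exact (pow_le_pow_left' (enorm_add_le v w) 2).trans h

theorem lintegral_iSup_fourierInv_le {H E : Type*} [NormedAddCommGroup H] [InnerProductSpace ℂ H]
    [CompleteSpace H] [NormedAddCommGroup E] [NormedSpace ℂ E] [CompleteSpace E]
    {ℓ : ℝ → H →L[ℂ] E} (hcont : Continuous ℓ) {L : ℕ} (hℓ : ∀ x v, ‖ℓ x v‖ ≤ 2 ^ L * ‖v‖)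
    {C : ℝ≥0} (hC : ∀ b v, ∫⁻ x in Set.Ico b (b + 1), ‖ℓ x v‖ₑ ^ 2 ≤ C * ‖v‖ₑ ^ 2)
    {m : ℝ → ℂ} (hm : Continuous m) {A : ℝ} (hA : ∀ η, ‖m η‖ ≤ A) {G : ℝ → H}
    (h1 : Integrable G) (h2 : MemLp G 2) :
    ∫⁻ x, ⨆ k : ℕ, ‖ℓ x (𝓕⁻ (fun ξ => m (2 ^ k * ξ) • G ξ) x)‖ₑ ^ 2 ≤
      2 * ((L + 1) * (4 + L * (18 * C)) * ∫⁻ ξ, ‖G ξ‖ₑ ^ 2) +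
      2 * ∑' k : ℕ, ∫⁻ x,
        ‖ℓ x (𝓕⁻ (fun ξ => (m (2 ^ k * ξ) - tentMult (2 ^ k * ξ)) • G ξ) x)‖ₑ ^ 2 := by
  set D : ℕ → ℝ → E := fun k x =>
    ℓ x (𝓕⁻ (fun ξ => (m (2 ^ k * ξ) - tentMult (2 ^ k * ξ)) • G ξ) x)
  have hmint := fun k : ℕ => integrable_mult_smul h1 hm hA (2 ^ k)
  have htint := fun k : ℕ =>
    integrable_mult_smul h1 continuous_tentMult norm_tentMult_le_one (2 ^ k)
  have hsplit : ∀ k x, ℓ x (𝓕⁻ (fun ξ => m (2 ^ k * ξ) • G ξ) x) =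
      ℓ x (tentAvg (𝓕⁻ G) (2 ^ k) x) + D k x := fun k x => by
    simp only [D, sub_smul]
    rw [tentAvg_fourierInv h1, fourierInv_sub_apply (hmint k) (htint k), map_sub, add_sub_cancel]
  have hmeas : ∀ k, Measurable fun x => ‖D k x‖ₑ ^ 2 := fun k => by
    have hint : Integrable fun ξ => (m (2 ^ k * ξ) - tentMult (2 ^ k * ξ)) • G ξ := by
      simpa only [sub_smul, Pi.sub_def] using (hmint k).sub (htint k)
    have hD : Continuous (D k) := hcont.clm_apply (continuous_fourierInv hint)
    exact hD.enorm.measurable.pow_const 2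
  calc ∫⁻ x, ⨆ k : ℕ, ‖ℓ x (𝓕⁻ (fun ξ => m (2 ^ k * ξ) • G ξ) x)‖ₑ ^ 2
      ≤ ∫⁻ x, (2 * (⨆ k : ℕ, ‖ℓ x (tentAvg (𝓕⁻ G) (2 ^ k) x)‖ₑ ^ 2) +
          2 * ∑' k, ‖D k x‖ₑ ^ 2) := by
        refine lintegral_mono fun x => iSup_le fun k => ?_
        rw [hsplit]
        refine (enorm_add_sq_le _ _).trans ?_
        gcongr
        · exact le_iSup (fun k : ℕ => ‖ℓ x (tentAvg (𝓕⁻ G) (2 ^ k) x)‖ₑ ^ 2) k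
        · exact ENNReal.le_tsum k
    _ = 2 * (∫⁻ x, ⨆ k : ℕ, ‖ℓ x (tentAvg (𝓕⁻ G) (2 ^ k) x)‖ₑ ^ 2) +
          2 * ∑' k, ∫⁻ x, ‖D k x‖ₑ ^ 2 := by
        rw [lintegral_add_right _ ((Measurable.tsum hmeas).const_mul 2),
          lintegral_const_mul' _ _ (by finiteness), lintegral_const_mul' _ _ (by finiteness),
          lintegral_tsum fun k => (hmeas k).aemeasurable]
    _ ≤ _ := by
        gcongr
        rw [← lintegral_fourierInv_sq h1 h2]
        have hcontℝ : Continuous fun x => (ℓ x).restrictScalars ℝ :=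
          (ContinuousLinearMap.continuous_restrictScalars (𝕜 := ℂ) ℝ).comp hcont
        let : InnerProductSpace ℝ H := .rclikeToReal ℂ H
        exact lintegral_iSup_tentAvg_le (continuous_fourierInv h1) hcontℝ hℓ hC

theorem IsLowPass.lintegral_iSup_expSum_fourierInv_le {m : ℝ → ℂ} (hm : IsLowPass m)
    (hcont : Continuous m) {ι : Type*} [Fintype ι] {θ : ι → ℝ}
    (hθ : Pairwise fun i j => 1 < |θ i - θ j|) {L : ℕ} (hL : Fintype.card ι ≤ 2 ^ L)
    {G : ℝ → EuclideanSpace ℂ ι} (h1 : Integrable G) (h2 : MemLp G 2)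
    (hsupp : ∀ ξ, 1 / 2 < |ξ| → G ξ = 0) :
    ∫⁻ x, ⨆ k : ℕ, ‖expSum θ x (𝓕⁻ (fun ξ => m (2 ^ k * ξ) • G ξ) x)‖ₑ ^ 2 ≤
      (60 * (L + 1)) ^ 2 * ∫⁻ ξ, ‖G ξ‖ₑ ^ 2 := by
  have hsq := tsum_lintegral_expSum_fourierInv_sq_le hθ h1 h2 hsupp (S := 324)
    (d := fun k ξ => m (2 ^ k * ξ) - tentMult (2 ^ k * ξ))
    (fun k => Continuous.sub (by fun_prop) (continuous_tentMult.comp (continuous_const_mul _)))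
    fun ξ => (tsum_enorm_comp_two_pow_mul_sq_le (d := fun η => m η - tentMult η)
      hm.norm_sub_tentMult_le hm.norm_sub_tentMult_mul_le ξ).trans_eq (by norm_num)
  have hnorm : ∀ x v, ‖expSum θ x v‖ ≤ 2 ^ L * ‖v‖ := fun x v =>
    (norm_expSum_apply_le θ x v).trans
      (mul_le_mul_of_nonneg_right (by exact_mod_cast hL) (norm_nonneg v))
  rw [ENNReal.coe_ofNat] at hsq
  refine (lintegral_iSup_fourierInv_le (continuous_expSum θ) hnorm (C := 64)
    (setLIntegral_expSum_sq_le hθ) hcont hm.norm_le_one h1 h2).trans ?_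
  rw [ENNReal.coe_ofNat]
  have hconst : 2 * ((L + 1) * (4 + L * (18 * 64))) + 2 * 324 ≤ (60 * (L + 1)) ^ 2 := by nlinarith
  calc _ ≤ 2 * ((L + 1) * (4 + L * (18 * 64)) * ∫⁻ ξ, ‖G ξ‖ₑ ^ 2) +
          2 * (324 * ∫⁻ ξ, ‖G ξ‖ₑ ^ 2) := by
        gcongr
    _ = (2 * ((L + 1) * (4 + L * (18 * 64))) + 2 * 324) * ∫⁻ ξ, ‖G ξ‖ₑ ^ 2 := by ring
    _ ≤ (60 * (L + 1)) ^ 2 * ∫⁻ ξ, ‖G ξ‖ₑ ^ 2 := by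
        gcongr
        exact_mod_cast hconst

theorem IsLowPass.eLpNorm_maximalFn_le {χ : 𝓢(ℝ, ℂ)} (hχ : IsLowPass (𝓕 (χ : ℝ → ℂ))) (k₀ : ℕ)
    {N L : ℕ} (hL : N ≤ 2 ^ L) {θ : Fin N → ℝ} (hθ : OneSeparated θ) {f : ℝ → ℂ}
    (hf : MemLp f 2) :
    eLpNorm (maximalFn χ θ k₀ f) 2 volume ≤ 60 * (L + 1) * eLpNorm f 2 volume := by
  set F : Lp ℂ 2 (volume : Measure ℝ) := 𝓕 (hf.toLp f)
  have hsep : Pairwise fun i j => 1 < |θ i - θ j| := fun i j => hθ i j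
  have hsup : ∀ x, ‖maximalFn χ θ k₀ f x‖ₑ ^ 2 ≤ ⨆ k, ‖Xi χ θ k f x‖ₑ ^ 2 := fun x => by
    rw [enorm_eq_self, maximalFn, ← ENNReal.iSup_pow]
    exact pow_le_pow_left' (iSup₂_le fun k _ => le_iSup (fun k => ‖Xi χ θ k f x‖ₑ) k) 2
  refine (ENNReal.pow_le_pow_left_iff two_ne_zero).1 ?_
  rw [mul_pow, ← eLpNorm_fourier_toLp hf, eLpNorm_two_sq, eLpNorm_two_sq]
  calc ∫⁻ x, ‖maximalFn χ θ k₀ f x‖ₑ ^ 2 ≤ ∫⁻ x, ⨆ k, ‖Xi χ θ k f x‖ₑ ^ 2 := lintegral_mono hsup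
    _ ≤ (60 * (L + 1)) ^ 2 * ∫⁻ ξ, ‖bands F θ ξ‖ₑ ^ 2 := by
        simp_rw [Xi_eq_expSum_fourierInv hf hχ]
        exact hχ.lintegral_iSup_expSum_fourierInv_le (contDiff_fourier_schwartz χ).continuous hsep
          (by simpa using hL) (integrable_bands (Lp.memLp F) θ) (memLp_bands (Lp.memLp F) θ)
          fun ξ => bands_eq_zero F θ
    _ ≤ (60 * (L + 1)) ^ 2 * ∫⁻ ξ, ‖F ξ‖ₑ ^ 2 :=
        mul_le_mul' le_rfl (lintegral_bands_sq_le hsep (Lp.memLp F))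

end MaximalInequality

section LogarithmicBounds

lemma natLog_two_add_two_le {N : ℕ} (hN : N ≠ 0) :
    (Nat.log 2 N + 2 : ℝ) ≤ 5 * Real.log (N + 1) := by
  have hpow : (2 : ℝ) ^ Nat.log 2 N ≤ N + 1 := by
    exact_mod_cast (Nat.pow_log_le_self 2 hN).trans N.le_succ
  have hlog := Real.log_le_log (by positivity) hpow
  have hN1 : (1 : ℝ) ≤ N := by exact_mod_cast Nat.one_le_iff_ne_zero.2 hN
  have htwo := Real.log_le_log two_pos (by linarith : (2 : ℝ) ≤ N + 1)
  rw [Real.log_pow] at hlog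
  nlinarith [Real.log_two_gt_d9, (Nat.log 2 N).cast_nonneg (α := ℝ)]

lemma log_natCast_add_one_le_rpow (N : ℕ) {ε : ℝ} (hε : 0 < ε) :
    Real.log (N + 1) ≤ (1 + 1 / ε) * (N : ℝ) ^ ε := by
  rcases N.eq_zero_or_pos with rfl | hN
  · simp [hε.ne']
  have hN1 : (1 : ℝ) ≤ N := by exact_mod_cast hN
  have hlog : Real.log (N + 1) ≤ 1 + Real.log N := by
    rw [← sub_le_iff_le_add, ← Real.log_div (by positivity) (by positivity)]
    refine (Real.log_le_sub_one_of_pos (by positivity)).trans ?_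
    rw [sub_le_iff_le_add, div_le_iff₀ (by positivity)]
    linarith
  have hpow := Real.one_le_rpow hN1 hε.le
  have hrpow := Real.log_le_rpow_div N.cast_nonneg hε
  rw [add_mul, one_div_mul_eq_div]
  linarith

lemma log_natCast_add_one_le_log_sq {N : ℕ} (hN : 2 ≤ N) :
    Real.log (N + 1) ≤ 3 * Real.log N ^ 2 := by
  have hN2 : (2 : ℝ) ≤ N := by exact_mod_cast hN
  have hlog : Real.log (N + 1) ≤ 2 * Real.log N := by
    rw [← Real.log_rpow (by positivity), Real.rpow_two]
    exact Real.log_le_log (by positivity) (by nlinarith)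
  have htwo := Real.log_le_log two_pos hN2
  nlinarith [Real.log_two_gt_d9]

end LogarithmicBounds

end MultiFreq

end

open MultiFreq in
theorem mainTheorem1_general {χ : 𝓢(ℝ, ℂ)} (hχ : IsLowPass (𝓕 (χ : ℝ → ℂ))) (k₀ : ℕ) {N : ℕ}
    {θ : Fin N → ℝ} (hθ : OneSeparated θ) {f : ℝ → ℂ} (hf : MemLp f 2 volume) :
    eLpNorm (maximalFn χ θ k₀ f) 2 volume ≤
      ENNReal.ofReal (300 * Real.log (N + 1)) * eLpNorm f 2 volume := by
  rcases eq_or_ne N 0 with rfl | hN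
  · have hzero : maximalFn χ θ k₀ f = 0 := by
      ext x
      simp [maximalFn, Xi]
    simp [hzero]
  refine (hχ.eLpNorm_maximalFn_le k₀ (Nat.lt_pow_succ_log_self one_lt_two N).le hθ hf).trans ?_
  gcongr
  have hnat : (60 * ((Nat.log 2 N).succ + 1) : ℝ≥0∞) =
      ENNReal.ofReal (60 * (Nat.log 2 N + 2)) := by
    rw [ENNReal.ofReal_mul (by norm_num), ENNReal.ofReal_add (by positivity) (by norm_num)]
    norm_num [add_assoc]
  rw [hnat]
  exact ENNReal.ofReal_le_ofReal (by linarith [natLog_two_add_two_le hN])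

theorem mainTheorem1 :
    (∀ ε : ℝ, 0 < ε → ∃ C : ℝ≥0,
      ∀ (χ : 𝓢(ℝ, ℂ)), MultiFreq.IsAdmissible χ →
      ∀ (k₀ N : ℕ) (θ : Fin N → ℝ), MultiFreq.OneSeparated θ →
      ∀ f : ℝ → ℂ, MemLp f 2 volume →
        eLpNorm (MultiFreq.maximalFn χ θ k₀ f) 2 volume ≤
          C * ENNReal.ofReal ((N : ℝ) ^ ε) * eLpNorm f 2 volume) ∧
    (∃ C : ℝ≥0,
      ∀ (χ : 𝓢(ℝ, ℂ)), MultiFreq.IsAdmissible χ →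
      ∀ (k₀ N : ℕ), 2 ≤ N → ∀ (θ : Fin N → ℝ), MultiFreq.OneSeparated θ →
      ∀ f : ℝ → ℂ, MemLp f 2 volume →
        eLpNorm (MultiFreq.maximalFn χ θ k₀ f) 2 volume ≤
          C * ENNReal.ofReal (Real.log N ^ 2) * eLpNorm f 2 volume) := by
  refine ⟨fun ε hε => ⟨(300 * (1 + 1 / ε)).toNNReal, fun χ hχ k₀ N θ hθ f hf => ?_⟩,
    900, fun χ hχ k₀ N hN θ hθ f hf => ?_⟩ <;>
  refine (mainTheorem1_general hχ.isLowPass k₀ hθ hf).trans ?_ <;> gcongr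
  · rw [← ENNReal.ofReal, ← ENNReal.ofReal_mul (by positivity), mul_assoc]
    gcongr
    exact MultiFreq.log_natCast_add_one_le_rpow N hε
  · rw [ENNReal.coe_ofNat, ← ENNReal.ofReal_ofNat, ← ENNReal.ofReal_mul (by norm_num)]
    exact ENNReal.ofReal_le_ofReal (by linarith [MultiFreq.log_natCast_add_one_le_log_sq hN])
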